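/- **Setting.** Let $p,q,n\ge 1$ be integers, let $\Sigma_0$ be a real symmetric positive semidefinite $pq\times pq$ matrix, and let $z_1,\dots,z_n$ be i.i.d. random vectors in $\mathbb R^{pq}$ with law $N(0,\Sigma_0)$. Let $\hat S_n=\frac1n\sum_{t=1}^n z_tz_t^T$ be the sample covariance matrix. For a $pq\times pq$ matrix $S$ with $q\times q$ blocks $S(i,j)$, $1\le i,j\le p$, let $\mathcal R(S)$ be the $p^2\times q^2$ matrix whose row with index $(i-1)p+j$ is $\mathrm{vec}(S(i,j))^T$, and put $R_0=\mathcal R(\Sigma_0)$, $\hat R_n=\mathcal R(\hat S_n)$. For $\lambda\ge 0$ let $\hat R_n^\lambda$ be a minimizer of $\|\hat R_n-R\|_F^2+\lambda\|R\|_*$ over $R\in\mathbb R^{p^2\times q^2}$ ($\|\cdot\|_F$ is the Frobenius norm, $\|\cdot\|_*$ the nuclear norm), and put $\hat\Sigma_n^\lambda=\mathcal R^{-1}(\hat R_n^\lambda)$. Let $\|\cdot\|_2$ be the spectral norm, $C_0=\|\Sigma_0\|_2$, $M=\max(p,q,n)$, $C_1=\frac{4e}{\sqrt{6\pi}}$,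 $C_2=e\sqrt2$, $C=\max(C_1,C_2)$. Fix $0<\epsilon'<\frac12$ and $t\ge\max\left(\sqrt{4C_1\ln(1+\tfrac2{\epsilon'})},\,4C_2\ln(1+\tfrac2{\epsilon'})\right)$, and set $$\lambda=\lambda_n=\frac{2C_0t}{1-2\epsilon'}\max\left\{\frac{p^2+q^2+\log M}{n},\sqrt{\frac{p^2+q^2+\log M}{n}}\right\}.$$ **Theorem.** (a) For every integer $1\le r\le\min(p^2,q^2)$, with probability at least $1-2M^{-t/(4C)}$, $$\|\hat\Sigma_n^\lambda-\Sigma_0\|_F^2\le\inf_{R\in\mathbb R^{p^2\times q^2}:\ \mathrm{rank}(R)\le r}\|R-R_0\|_F^2+C'\,r\,\max\left\{\left(\frac{p^2+q^2+\log M}{n}\right)^2,\frac{p^2+q^2+\log M}{n}\right\},\qquad C'=\left(C_0t\,\frac{1+\sqrt2}{1-2\epsilon'}\right)^2.$$ (b) Consequently, with $\epsilon'$ and $t$ fixed, consider a sequence of such problems indexed by $k\in\mathbb N$, with dimensions $p_k,q_k\ge1$, sample sizes $n_k\ge1$, $M_k=\max(p_k,q_k,n_k)$ and covariances $\Sigma_{0,k}$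 such that $\sup_k\|\Sigma_{0,k}\|_2<\infty$, $p_k^2+q_k^2+\log M_k=o(n_k)$, and $\Sigma_{0,k}=\sum_{\gamma=1}^{r_k}A_{k,\gamma}\otimes B_{k,\gamma}$ for some linearly independent $p_k\times p_k$ matrices $A_{k,\gamma}$ and linearly independent $q_k\times q_k$ matrices $B_{k,\gamma}$, $r_k\ge1$. Then the errors $X_k=\|\hat\Sigma_{n_k}^{\lambda}-\Sigma_{0,k}\|_F^2$ satisfy $X_k=O_P(b_k)$ with $b_k=\frac{r_k(p_k^2+q_k^2+\log M_k)}{n_k}$, that is, $\sup_k\Pr(|X_k/b_k|>K)\to0$ as $K\to\infty$. -/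

import Mathlib

open MeasureTheory ProbabilityTheory Filter Topology
open scoped Matrix

namespace PRLS

/-- Frobenius norm of a real matrix. -/
noncomputable def frobNorm {m n : Type*} [Fintype m] [Fintype n] (A : Matrix m n ℝ) : ℝ :=
  @Norm.norm (Matrix m n ℝ) Matrix.frobeniusNormedAddCommGroup.toNorm A

/-- Spectral norm of a real matrix (operator norm between Euclidean spaces). -/
noncomputable def specNorm {m n : Type*} [Fintype m] [Fintype n] [DecidableEq n]
    (A : Matrix m n ℝ) : ℝ :=
  @Norm.norm (Matrix m n ℝ) Matrix.instL2OpNormedAddCommGroup.toNorm A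

/-- Nuclear norm: the sum of the first `rank A` singular values (in decreasing order, with
multiplicity). -/
noncomputable def nuclearNorm {m n : Type*} [Fintype m] [Fintype n] [DecidableEq m]
    [DecidableEq n] (A : Matrix m n ℝ) : ℝ :=
  ∑ l ∈ Finset.range A.rank, (Matrix.toEuclideanLin A).singularValues l

/-- The permutation operator from `pq × pq` matrices to `p² × q²` matrices. The index
`(i, k) : Fin p × Fin q` of a `pq`-vector is the `k`-th position of the `i`-th block, so that the
row `(i, j)` of the image lists the entries of the block `(i, j)`. -/
def rearrange (p q : ℕ) :
    Matrix (Fin p × Fin q) (Fin p × Fin q) ℝ ≃ Matrix (Fin p × Fin p) (Fin q × Fin q) ℝ where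
  toFun S := Matrix.of fun ij kl => S (ij.1, kl.1) (ij.2, kl.2)
  invFun R := Matrix.of fun ik jl => R (ik.1, jl.1) (ik.2, jl.2)
  left_inv _ := rfl
  right_inv _ := rfl

/-- Sample covariance matrix `(1/n) ∑ₜ zₜ zₜᵀ`. -/
noncomputable def sampleCov {ι : Type*} {n : ℕ} (z : Fin n → EuclideanSpace ℝ ι) :
    Matrix ι ι ℝ :=
  (1 / (n : ℝ)) • ∑ t, Matrix.vecMulVec (z t) (z t)

/-- `R` solves the nuclear norm penalized least squares problem
`min_R ‖Y - R‖_F² + lam ‖R‖_*`. -/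
def IsPRLSSolution {m n : Type*} [Fintype m] [Fintype n] [DecidableEq m] [DecidableEq n]
    (lam : ℝ) (Y R : Matrix m n ℝ) : Prop :=
  IsMinOn (fun R' => frobNorm (Y - R') ^ 2 + lam * nuclearNorm R') Set.univ R

/-- `z 0, …, z (n-1)` are i.i.d. centred Gaussian vectors with covariance `S`. -/
def IsIIDGaussian {Ω ι : Type*} [MeasurableSpace Ω] [Fintype ι] [DecidableEq ι] (P : Measure Ω)
    (S : Matrix ι ι ℝ) {n : ℕ} (z : Fin n → Ω → EuclideanSpace ℝ ι) : Prop :=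
  iIndepFun z P ∧ ∀ t, HasLaw (z t) (multivariateGaussian 0 S) P

/-- `S = ∑_γ A_γ ⊗ B_γ` with `r` terms, the `A_γ` being linearly independent and the `B_γ` being
linearly independent. -/
def HasSeparationRank {p q : ℕ} (S : Matrix (Fin p × Fin q) (Fin p × Fin q) ℝ) (r : ℕ) : Prop :=
  ∃ (A : Fin r → Matrix (Fin p) (Fin p) ℝ) (B : Fin r → Matrix (Fin q) (Fin q) ℝ),
    LinearIndependent ℝ A ∧ LinearIndependent ℝ B ∧
      S = ∑ γ, Matrix.kroneckerMap (fun a b => a * b) (A γ) (B γ)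

/-- `X k = O_P(b k)`: `sup_k P(|X k / b k| > K) → 0` as `K → ∞`. -/
def IsBigOP {Ω : Type*} [MeasurableSpace Ω] (P : Measure Ω) (X : ℕ → Ω → ℝ) (b : ℕ → ℝ) : Prop :=
  Tendsto (fun K : ℝ => ⨆ k, P {ω | K < |X k ω / b k|}) atTop (𝓝 0)

/-- The absolute constant `C₁ = 4e / √(6π)`. -/
noncomputable def C₁ : ℝ := 4 * Real.exp 1 / √(6 * Real.pi)

/-- The absolute constant `C₂ = e √2`. -/
noncomputable def C₂ : ℝ := Real.exp 1 * √2

/-- `M = max(p, q, n)`, as a real number. -/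
noncomputable def bigM (p q n : ℕ) : ℝ := (max (max p q) n : ℕ)

/-- `(p² + q² + log M) / n`. -/
noncomputable def rate (p q n : ℕ) : ℝ :=
  ((p : ℝ) ^ 2 + (q : ℝ) ^ 2 + Real.log (bigM p q n)) / n

/-- The regularization parameter
`λ_n = 2 C₀ t / (1 - 2 ε') * max {(p² + q² + log M) / n, √((p² + q² + log M) / n)}`. -/
noncomputable def lamN (C₀ t ε' : ℝ) (p q n : ℕ) : ℝ :=
  2 * C₀ * t / (1 - 2 * ε') * max (rate p q n) (√(rate p q n))

end PRLS

open PRLS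

/-!
The proof separates a deterministic oracle inequality from a concentration bound for the noise
`Δ = 𝓡(Ŝ) - 𝓡(S₀)`.

*Oracle inequality* (`IsPRLSSolution.oracle_inequality`). If `‖Δ‖₂ ≤ λ / 2`, write `2 Δ = λ G` with
`G` a contraction. Strong convexity of the criterion (`IsPRLSSolution.quadratic_growth`) gives, for
a competitor `R` of rank at most `r` and `D = R̂ - R`,
`‖R̂ - R₀‖² + ‖D‖² ≤ ‖R - R₀‖² + λ ⟨G, D⟩ + λ (‖R‖_* - ‖R̂‖_*)`. By duality
(`frobInner_le_nuclearNorm`), `‖R‖_* - ‖R̂‖_* ≤ -⟨V, D⟩` for every contraction `V` with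
`⟨V, R⟩ = ‖R‖_*`. Taking for `V` the polar factor of `R` plus the corner of `G` orthogonal to the
row and column spaces of `R` makes `‖G - V‖_F ≤ (1 + √2) √r` (`exists_subgradient_near`), and
completing the square in `‖D‖` concludes. No subdifferential calculus is needed.

*Noise* (`IsIIDGaussian.measureReal_noise_le`). For unit vectors `x`, `y` the number `xᵀ Δ y` is the
centred empirical average of the quadratic form `zᵀ K z`, where `K` is the Kronecker product of the
matrices with entries `x` and `y` and has Frobenius norm one. In an eigenbasis such a form is a
combination of independent centred chi-square variables with coefficients of square sum at most
`‖S₀‖₂²`, so its moment generating function is explicit and Chernoff's bound gives the tail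
`exp (-n u² / (4 (1 + u)))` at level `‖S₀‖₂ u`. A union bound over `ε'`-nets of the two spheres, of
cardinalities at most `(1 + 2 / ε') ^ p²` and `(1 + 2 / ε') ^ q²`, yields failure probability
`M ^ (-t / (4 max {C₁, C₂}))`; the hypothesis on `t` is exactly what absorbs the entropy of the nets.
This tail is stronger than the one with constants `C₁`, `C₂` since both are at least `2`, and it
needs no factor `2` because the nets already range over both signs of `x`.

*Rates.* If `S₀` has separation rank `r`, then `𝓡(S₀)` has rank at most `r` and the approximation
term vanishes. As the rate tends to zero, `M ≥ rate⁻¹` tends to infinity, which makes the failure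
probability small for all but finitely many problems. The remaining ones are handled one at a time,
by tightness of each single error. The estimator is not assumed measurable: the sets involving it
are only ever compared, through outer measure, with events depending on the sample.
-/

namespace PRLS

/-! ### Frobenius and spectral norms, singular value decomposition -/

section Norms

variable {m n k : Type*} [Fintype m] [Fintype n] [Fintype k]

lemma frobNorm_sq (A : Matrix m n ℝ) : frobNorm A ^ 2 = ∑ i, ∑ j, A i j ^ 2 := by
  unfold frobNorm
  rw [Matrix.frobenius_norm_def, ← Real.sqrt_eq_rpow, Real.sq_sqrt]
  · simp
  · positivity

lemma frobNorm_nonneg (A : Matrix m n ℝ) : 0 ≤ frobNorm A :=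
  by
  let _ := Matrix.frobeniusNormedAddCommGroup (m := m) (n := n) (α := ℝ)
  exact norm_nonneg A

lemma frobNorm_add_le (A B : Matrix m n ℝ) : frobNorm (A + B) ≤ frobNorm A + frobNorm B :=
  by
  let _ := Matrix.frobeniusNormedAddCommGroup (m := m) (n := n) (α := ℝ)
  exact norm_add_le A B

lemma frobNorm_transpose (A : Matrix m n ℝ) : frobNorm Aᵀ = frobNorm A :=
  Matrix.frobenius_norm_transpose A

lemma frobNorm_sub_comm (A B : Matrix m n ℝ) : frobNorm (A - B) = frobNorm (B - A) :=
  by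
  let _ := Matrix.frobeniusNormedAddCommGroup (m := m) (n := n) (α := ℝ)
  exact norm_sub_rev A B

lemma frobNorm_neg (A : Matrix m n ℝ) : frobNorm (-A) = frobNorm A :=
  by
  let _ := Matrix.frobeniusNormedAddCommGroup (m := m) (n := n) (α := ℝ)
  exact norm_neg A

lemma frobNorm_smul (c : ℝ) (A : Matrix m n ℝ) : frobNorm (c • A) = |c| * frobNorm A := by
  rw [← sq_eq_sq₀ (frobNorm_nonneg _) (mul_nonneg (abs_nonneg _) (frobNorm_nonneg _)), mul_pow,
    frobNorm_sq, frobNorm_sq, sq_abs]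
  simp [mul_pow, Finset.mul_sum]

/-- The Frobenius inner product `tr(Aᵀ B)`. -/
def frobInner (A B : Matrix m n ℝ) : ℝ := (Aᵀ * B).trace

lemma frobInner_eq_sum (A B : Matrix m n ℝ) : frobInner A B = ∑ i, ∑ j, A i j * B i j := by
  simp only [frobInner, Matrix.trace, Matrix.diag_apply, Matrix.mul_apply, Matrix.transpose_apply]
  exact Finset.sum_comm

lemma frobInner_self (A : Matrix m n ℝ) : frobInner A A = frobNorm A ^ 2 := by
  rw [frobInner_eq_sum, frobNorm_sq]
  simp [sq]

lemma frobInner_comm (A B : Matrix m n ℝ) : frobInner A B = frobInner B A := by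
  simp [frobInner_eq_sum, mul_comm]

lemma frobInner_add_left (A B C : Matrix m n ℝ) :
    frobInner (A + B) C = frobInner A C + frobInner B C := by
  simp [frobInner, Matrix.add_mul]

lemma frobInner_add_right (A B C : Matrix m n ℝ) :
    frobInner A (B + C) = frobInner A B + frobInner A C := by
  simp [frobInner, Matrix.mul_add]

lemma frobInner_sub_left (A B C : Matrix m n ℝ) :
    frobInner (A - B) C = frobInner A C - frobInner B C := by
  simp [frobInner, Matrix.sub_mul]

lemma frobInner_sub_right (A B C : Matrix m n ℝ) :
    frobInner A (B - C) = frobInner A B - frobInner A C := by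
  simp [frobInner, Matrix.mul_sub]

lemma frobInner_smul_left (c : ℝ) (A B : Matrix m n ℝ) :
    frobInner (c • A) B = c * frobInner A B := by
  simp [frobInner]

lemma frobInner_smul_right (c : ℝ) (A B : Matrix m n ℝ) :
    frobInner A (c • B) = c * frobInner A B := by
  simp [frobInner]

lemma frobNorm_sub_sq (A B : Matrix m n ℝ) :
    frobNorm (A - B) ^ 2 = frobNorm A ^ 2 - 2 * frobInner A B + frobNorm B ^ 2 := by
  simp only [← frobInner_self, frobInner_sub_left, frobInner_sub_right, frobInner_comm B A]
  ring

lemma frobNorm_add_sq (A B : Matrix m n ℝ) :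
    frobNorm (A + B) ^ 2 = frobNorm A ^ 2 + 2 * frobInner A B + frobNorm B ^ 2 := by
  simp only [← frobInner_self, frobInner_add_left, frobInner_add_right, frobInner_comm B A]
  ring

lemma frobInner_le (A B : Matrix m n ℝ) : frobInner A B ≤ frobNorm A * frobNorm B := by
  apply le_of_sq_le_sq _ (mul_nonneg (frobNorm_nonneg A) (frobNorm_nonneg B))
  rw [mul_pow, frobNorm_sq, frobNorm_sq, frobInner_eq_sum, ← Fintype.sum_prod_type',
    ← Fintype.sum_prod_type', ← Fintype.sum_prod_type']
  exact Finset.sum_mul_sq_le_sq_mul_sq _ _ _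

lemma frobNorm_sq_eq_sum_col (A : Matrix m n ℝ) :
    frobNorm A ^ 2 = ∑ j, (A.col j) ⬝ᵥ (A.col j) := by
  rw [frobNorm_sq, Finset.sum_comm]
  simp [dotProduct, sq]

lemma norm_toLp_sq (x : n → ℝ) : ‖WithLp.toLp 2 x‖ ^ 2 = x ⬝ᵥ x := by
  rw [EuclideanSpace.real_norm_sq_eq]
  simp [dotProduct, sq]

variable [DecidableEq n]

lemma specNorm_nonneg (A : Matrix m n ℝ) : 0 ≤ specNorm A :=
  by
  let _ := Matrix.instL2OpNormedAddCommGroup (𝕜 := ℝ) (m := m) (n := n)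
  exact norm_nonneg A

lemma specNorm_smul (c : ℝ) (A : Matrix m n ℝ) : specNorm (c • A) = |c| * specNorm A := by
  let _ := Matrix.instL2OpNormedAddCommGroup (𝕜 := ℝ) (m := m) (n := n)
  let _ := Matrix.instL2OpNormedSpace (𝕜 := ℝ) (m := m) (n := n)
  exact norm_smul c A

lemma specNorm_zero : specNorm (0 : Matrix m n ℝ) = 0 :=
  by
  let _ := Matrix.instL2OpNormedAddCommGroup (𝕜 := ℝ) (m := m) (n := n)
  exact norm_zero

lemma eq_zero_of_specNorm_eq_zero {A : Matrix m n ℝ} (h : specNorm A = 0) : A = 0 :=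
  by
  let _ := Matrix.instL2OpNormedAddCommGroup (𝕜 := ℝ) (m := m) (n := n)
  exact norm_eq_zero.1 h

lemma mulVec_dotProduct_self_le (A : Matrix m n ℝ) (x : n → ℝ) :
    (A *ᵥ x) ⬝ᵥ (A *ᵥ x) ≤ specNorm A ^ 2 * (x ⬝ᵥ x) := by
  have h := Matrix.l2_opNorm_mulVec A (WithLp.toLp 2 x)
  have h2 := pow_le_pow_left₀ (norm_nonneg _) h 2
  rw [mul_pow] at h2
  rw [← norm_toLp_sq, ← norm_toLp_sq]
  exact h2

lemma specNorm_le_of_forall {A : Matrix m n ℝ} {c : ℝ} (hc : 0 ≤ c)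
    (h : ∀ x : EuclideanSpace ℝ n, ‖Matrix.toEuclideanLin A x‖ ≤ c * ‖x‖) : specNorm A ≤ c := by
  unfold specNorm
  rw [Matrix.l2_opNorm_def]
  exact ContinuousLinearMap.opNorm_le_bound _ hc h

lemma norm_toEuclideanLin_le (A : Matrix m n ℝ) (x : EuclideanSpace ℝ n) :
    ‖Matrix.toEuclideanLin A x‖ ≤ specNorm A * ‖x‖ := Matrix.l2_opNorm_mulVec A x

lemma specNorm_le_one {A : Matrix m n ℝ}
    (h : ∀ x : n → ℝ, (A *ᵥ x) ⬝ᵥ (A *ᵥ x) ≤ x ⬝ᵥ x) : specNorm A ≤ 1 := by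
  refine specNorm_le_of_forall zero_le_one fun x => ?_
  rw [one_mul]
  apply le_of_sq_le_sq _ (norm_nonneg _)
  have h1 := h x.ofLp
  rw [← norm_toLp_sq, ← norm_toLp_sq] at h1
  exact h1

/-- The Frobenius norm of a product is at most the spectral norm of the first factor times the
Frobenius norm of the second one: compare the products column by column. -/
lemma frobNorm_mul_le (A : Matrix m n ℝ) (B : Matrix n k ℝ) :
    frobNorm (A * B) ≤ specNorm A * frobNorm B := by
  apply le_of_sq_le_sq _ (mul_nonneg (specNorm_nonneg _) (frobNorm_nonneg _))
  rw [mul_pow, frobNorm_sq_eq_sum_col, frobNorm_sq_eq_sum_col, Finset.mul_sum]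
  exact Finset.sum_le_sum fun j _ => mulVec_dotProduct_self_le A (B.col j)

variable [DecidableEq m]

lemma specNorm_transpose (A : Matrix m n ℝ) : specNorm Aᵀ = specNorm A := by
  have := Matrix.l2_opNorm_conjTranspose A
  rwa [Matrix.conjTranspose_eq_transpose_of_trivial] at this

lemma frobNorm_mul_le' (A : Matrix k m ℝ) (B : Matrix m n ℝ) :
    frobNorm (A * B) ≤ frobNorm A * specNorm B := by
  have h := frobNorm_mul_le Bᵀ Aᵀ
  rwa [← Matrix.transpose_mul, frobNorm_transpose, frobNorm_transpose, specNorm_transpose,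
    mul_comm] at h

end Norms

section SVD

variable {m n : Type*} [Fintype m] [Fintype n] [DecidableEq m] [DecidableEq n]

/-- Thin singular value decomposition `A = U diag(s) Wᵀ` with `rank A` positive singular values. -/
theorem exists_thin_svd (A : Matrix m n ℝ) :
    ∃ (U : Matrix m (Fin A.rank) ℝ) (W : Matrix n (Fin A.rank) ℝ) (s : Fin A.rank → ℝ),
      Uᵀ * U = 1 ∧ Wᵀ * W = 1 ∧ A = U * Matrix.diagonal s * Wᵀ ∧ (∀ l, 0 ≤ s l) ∧
        nuclearNorm A = ∑ l, s l := by
  set T := Matrix.toEuclideanLin A with hT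
  have hn : Module.finrank ℝ (EuclideanSpace ℝ n) = Fintype.card n := finrank_euclideanSpace
  set v := T.isSymmetric_adjoint_comp_self.eigenvectorBasis hn with hv
  have hrank : A.rank = Module.finrank ℝ T.range :=
    A.rank_eq_finrank_range_toLin (EuclideanSpace.basisFun m ℝ).toBasis
      (EuclideanSpace.basisFun n ℝ).toBasis
  have hle : A.rank ≤ Fintype.card n := A.rank_le_card_width
  have hinner : ∀ i j, inner ℝ (T (v i)) (T (v j)) =
      if i = j then T.singularValues i ^ 2 else 0 := by
    intro i j
    rw [← LinearMap.adjoint_inner_right, ← LinearMap.comp_apply, hv,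
      LinearMap.IsSymmetric.apply_eigenvectorBasis, inner_smul_right, ← hv,
      OrthonormalBasis.inner_eq_ite]
    split_ifs with h
    · subst h
      rw [T.sq_singularValues_fin hn i]
      simp
    · simp
  have hpos : ∀ l : Fin A.rank, 0 < T.singularValues l := fun l =>
    T.singularValues_pos_iff_lt_finrank_range.2 (hrank ▸ l.2)
  have hzero : ∀ j : Fin (Fintype.card n), A.rank ≤ j → T (v j) = 0 := by
    intro j hj
    rw [← inner_self_eq_zero (𝕜 := ℝ), hinner, if_pos rfl,
      T.singularValues_eq_zero_iff_le_finrank_range.2 (hrank ▸ hj)]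
    simp
  refine ⟨Matrix.of fun i l => (T.singularValues l)⁻¹ * (T (v (Fin.castLE hle l))) i,
    Matrix.of fun j l => v (Fin.castLE hle l) j, fun l => T.singularValues l, ?_, ?_, ?_,
    fun l => (hpos l).le, ?_⟩
  · ext l l'
    have h := hinner (Fin.castLE hle l) (Fin.castLE hle l')
    rw [PiLp.inner_apply] at h
    have h2 : (∑ i, (T.singularValues l)⁻¹ * (T (v (Fin.castLE hle l))) i *
        ((T.singularValues l')⁻¹ * (T (v (Fin.castLE hle l'))) i)) =
        (T.singularValues l)⁻¹ * (T.singularValues l')⁻¹ *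
          ∑ i, inner ℝ (T (v (Fin.castLE hle l)) i) (T (v (Fin.castLE hle l')) i) := by
      rw [Finset.mul_sum]
      refine Finset.sum_congr rfl fun i _ => ?_
      simp only [RCLike.inner_apply, conj_trivial]
      ring
    rw [Matrix.mul_apply]
    simp only [Matrix.transpose_apply, Matrix.of_apply]
    rw [h2, h, Matrix.one_apply]
    have := (hpos l).ne'
    by_cases hll : l = l'
    · subst hll
      simp only [if_true, Fin.val_castLE]
      field_simp
    · rw [if_neg hll, if_neg (fun h => hll (Fin.castLE_injective hle h)), mul_zero]
  · ext l l'
    have h := v.inner_eq_ite (Fin.castLE hle l) (Fin.castLE hle l')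
    rw [PiLp.inner_apply] at h
    rw [Matrix.mul_apply, Matrix.one_apply]
    simp only [Matrix.transpose_apply, Matrix.of_apply]
    simp only [RCLike.inner_apply, conj_trivial, Fin.castLE_inj] at h
    rw [← h]
    exact Finset.sum_congr rfl fun i _ => mul_comm _ _
  · apply Matrix.toEuclideanLin.injective
    apply v.toBasis.ext
    intro j
    rw [OrthonormalBasis.coe_toBasis]
    ext i
    change T (v j) i = ((_ * Matrix.diagonal _ * _ : Matrix m n ℝ) *ᵥ (v j).ofLp) i
    rw [← Matrix.mulVec_mulVec]
    have hcoef : ∀ l : Fin A.rank, ((Matrix.of fun j l => v (Fin.castLE hle l) j :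
        Matrix n (Fin A.rank) ℝ)ᵀ *ᵥ (v j).ofLp) l = if Fin.castLE hle l = j then 1 else 0 := by
      intro l
      have h := v.inner_eq_ite (Fin.castLE hle l) j
      rw [PiLp.inner_apply] at h
      rw [← h]
      simp only [Matrix.mulVec, dotProduct, Matrix.transpose_apply, Matrix.of_apply,
        RCLike.inner_apply, conj_trivial]
      exact Finset.sum_congr rfl fun i _ => mul_comm _ _
    rw [Matrix.mulVec, dotProduct]
    simp_rw [hcoef, Matrix.mul_diagonal, Matrix.of_apply]
    by_cases hj : (j : ℕ) < A.rank
    · rw [Finset.sum_eq_single (⟨j, hj⟩ : Fin A.rank)]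
      · have : Fin.castLE hle ⟨j, hj⟩ = j := by ext; simp
        rw [this]
        have := (hpos ⟨j, hj⟩).ne'
        simp only at this
        simp only [if_true]
        field_simp
      · intro l _ hl
        rw [if_neg, mul_zero]
        rintro rfl
        exact hl (by ext; simp)
      · simp
    · rw [hzero j (not_lt.1 hj), Finset.sum_eq_zero]
      · simp
      · intro l _
        rw [if_neg, mul_zero]
        rintro rfl
        exact hj l.2
  · rw [nuclearNorm, Finset.sum_range]

end SVD

/-! ### Nuclear norm duality and the oracle inequality -/

section Duality

variable {m n k : Type*} [Fintype m] [Fintype n] [Fintype k]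

lemma mulVec_dotProduct_eq (U : Matrix m k ℝ) (a : k → ℝ) (w : m → ℝ) :
    (U *ᵥ a) ⬝ᵥ w = a ⬝ᵥ (Uᵀ *ᵥ w) := by
  rw [Matrix.mulVec_transpose, dotProduct_comm, Matrix.dotProduct_mulVec, dotProduct_comm]

lemma dotProduct_self_nonneg' (x : m → ℝ) : 0 ≤ x ⬝ᵥ x :=
  Finset.sum_nonneg fun i _ => mul_self_nonneg (x i)

variable [DecidableEq k]

lemma frobNorm_mul_transpose_sq {U : Matrix m k ℝ} {W : Matrix n k ℝ} (hU : Uᵀ * U = 1)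
    (hW : Wᵀ * W = 1) : frobNorm (U * Wᵀ) ^ 2 = Fintype.card k := by
  rw [← frobInner_self, frobInner, Matrix.transpose_mul, Matrix.transpose_transpose,
    Matrix.mul_assoc, ← Matrix.mul_assoc Uᵀ, hU, Matrix.one_mul, Matrix.trace_mul_comm, hW,
    Matrix.trace_one]

lemma transpose_mulVec_mulVec {U : Matrix m k ℝ} (hU : Uᵀ * U = 1) (a : k → ℝ) :
    Uᵀ *ᵥ (U *ᵥ a) = a := by
  rw [Matrix.mulVec_mulVec, hU, Matrix.one_mulVec]

variable [DecidableEq m]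

lemma compl_mulVec_dotProduct_self {U : Matrix m k ℝ} (hU : Uᵀ * U = 1) (z : m → ℝ) :
    ((1 - U * Uᵀ) *ᵥ z) ⬝ᵥ ((1 - U * Uᵀ) *ᵥ z) = z ⬝ᵥ z - (Uᵀ *ᵥ z) ⬝ᵥ (Uᵀ *ᵥ z) := by
  simp only [Matrix.sub_mulVec, Matrix.one_mulVec, ← Matrix.mulVec_mulVec, sub_dotProduct,
    dotProduct_sub, mulVec_dotProduct_eq, transpose_mulVec_mulVec hU]
  rw [Matrix.transpose_transpose]
  ring

lemma specNorm_compl_le_one {U : Matrix m k ℝ} (hU : Uᵀ * U = 1) : specNorm (1 - U * Uᵀ) ≤ 1 := by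
  refine specNorm_le_one fun x => ?_
  rw [compl_mulVec_dotProduct_self hU]
  linarith [dotProduct_self_nonneg' (Uᵀ *ᵥ x)]

variable [DecidableEq n]

/-- Pairing with a contraction is dominated by the nuclear norm. -/
theorem frobInner_le_nuclearNorm {V : Matrix m n ℝ} (hV : specNorm V ≤ 1) (A : Matrix m n ℝ) :
    frobInner V A ≤ nuclearNorm A := by
  obtain ⟨U, W, s, hU, hW, hA, hs, hN⟩ := exists_thin_svd A
  have hcol : ∀ l, (Wᵀ * (Vᵀ * U)) l l ≤ 1 := by
    intro l
    have h1 : (Wᵀ * (Vᵀ * U)) l l = (V *ᵥ W.col l) ⬝ᵥ U.col l := by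
      rw [mulVec_dotProduct_eq]
      rfl
    have hu : U.col l ⬝ᵥ U.col l = 1 := by
      have := congrFun (congrFun hU l) l
      rwa [Matrix.one_apply_eq] at this
    have hw : W.col l ⬝ᵥ W.col l = 1 := by
      have := congrFun (congrFun hW l) l
      rwa [Matrix.one_apply_eq] at this
    have hv := mulVec_dotProduct_self_le V (W.col l)
    have hV2 : specNorm V ^ 2 ≤ 1 := pow_le_one₀ (specNorm_nonneg V) hV
    have hd := dotProduct_self_nonneg' (V *ᵥ W.col l - U.col l)
    simp only [sub_dotProduct, dotProduct_sub] at hd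
    rw [dotProduct_comm (U.col l) (V *ᵥ W.col l), hu] at hd
    rw [hw] at hv
    rw [h1]
    linarith
  have h2 : frobInner V A = ∑ l, s l * (Wᵀ * (Vᵀ * U)) l l := by
    conv_lhs => rw [hA]
    rw [frobInner, ← Matrix.mul_assoc, ← Matrix.mul_assoc, Matrix.trace_mul_comm,
      ← Matrix.mul_assoc, Matrix.trace]
    exact Finset.sum_congr rfl fun l _ => by
      rw [Matrix.diag_apply, Matrix.mul_diagonal, mul_comm]
  rw [h2, hN]
  exact Finset.sum_le_sum fun l _ => mul_le_of_le_one_right (hs l) (hcol l)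

/-- Every contraction `G` is close to a subgradient `V` of the nuclear norm at `A`: with the thin
singular value decomposition `A = U diag(s) Wᵀ`, replace by `U Wᵀ` the part of `G` outside the
corner `(1 - U Uᵀ) G (1 - W Wᵀ)`. The part removed from `G` is an orthogonal sum of two matrices of
squared Frobenius norm at most `rank A`. -/
theorem exists_subgradient_near {G : Matrix m n ℝ} (hG : specNorm G ≤ 1) (A : Matrix m n ℝ) :
    ∃ V : Matrix m n ℝ, specNorm V ≤ 1 ∧ frobInner V A = nuclearNorm A ∧
      frobNorm (G - V) ≤ (1 + √2) * √A.rank := by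
  obtain ⟨U, W, s, hU, hW, hA, hs, hN⟩ := exists_thin_svd A
  have hQU : (1 - U * Uᵀ) * U = 0 := by
    rw [Matrix.sub_mul, Matrix.mul_assoc, hU, Matrix.one_mul, Matrix.mul_one, sub_self]
  have hUQ : Uᵀ * (1 - U * Uᵀ) = 0 := by
    rw [Matrix.mul_sub, ← Matrix.mul_assoc, hU, Matrix.one_mul, Matrix.mul_one, sub_self]
  have hQt : (1 - U * Uᵀ)ᵀ = 1 - U * Uᵀ := by
    simp [Matrix.transpose_mul]
  have hrk : ((Fintype.card (Fin A.rank) : ℕ) : ℝ) = A.rank := by simp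
  refine ⟨U * Wᵀ + (1 - U * Uᵀ) * G * (1 - W * Wᵀ), ?_, ?_, ?_⟩
  · refine specNorm_le_one fun x => ?_
    set y := (1 - W * Wᵀ) *ᵥ x with hy
    have hVx : (U * Wᵀ + (1 - U * Uᵀ) * G * (1 - W * Wᵀ)) *ᵥ x =
        U *ᵥ (Wᵀ *ᵥ x) + (1 - U * Uᵀ) *ᵥ (G *ᵥ y) := by
      simp only [Matrix.add_mulVec, hy, Matrix.mulVec_mulVec, Matrix.mul_assoc]
    have h0 : (U *ᵥ (Wᵀ *ᵥ x)) ⬝ᵥ ((1 - U * Uᵀ) *ᵥ (G *ᵥ y)) = 0 := by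
      rw [mulVec_dotProduct_eq, Matrix.mulVec_mulVec, hUQ, Matrix.zero_mulVec, dotProduct_zero]
    have h1 : (U *ᵥ (Wᵀ *ᵥ x)) ⬝ᵥ (U *ᵥ (Wᵀ *ᵥ x)) = (Wᵀ *ᵥ x) ⬝ᵥ (Wᵀ *ᵥ x) := by
      rw [mulVec_dotProduct_eq, transpose_mulVec_mulVec hU]
    have h2 := compl_mulVec_dotProduct_self hU (G *ᵥ y)
    have h3 := mulVec_dotProduct_self_le G y
    have h4 : specNorm G ^ 2 ≤ 1 := pow_le_one₀ (specNorm_nonneg G) hG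
    have h5 := compl_mulVec_dotProduct_self hW x
    rw [← hy] at h5
    have h6 := mul_le_mul_of_nonneg_right h4 (dotProduct_self_nonneg' y)
    have h7 := dotProduct_self_nonneg' (Uᵀ *ᵥ (G *ᵥ y))
    rw [hVx]
    simp only [add_dotProduct, dotProduct_add]
    rw [dotProduct_comm ((1 - U * Uᵀ) *ᵥ (G *ᵥ y)), h0, h1, h2]
    linarith
  · rw [frobInner_add_left]
    have h1 : frobInner ((1 - U * Uᵀ) * G * (1 - W * Wᵀ)) A = 0 := by
      rw [frobInner, Matrix.transpose_mul, Matrix.transpose_mul, hQt]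
      have : (1 - U * Uᵀ) * A = 0 := by
        have h := congrArg ((1 - U * Uᵀ) * ·) hA
        simp only [← Matrix.mul_assoc, hQU, Matrix.zero_mul] at h
        exact h
      rw [Matrix.mul_assoc, Matrix.mul_assoc, this]
      simp
    have h2 : frobInner (U * Wᵀ) A = ∑ l, s l := by
      refine (congrArg (frobInner (U * Wᵀ)) hA).trans ?_
      rw [frobInner, Matrix.transpose_mul, Matrix.transpose_transpose, Matrix.mul_assoc,
        ← Matrix.mul_assoc Uᵀ, ← Matrix.mul_assoc Uᵀ, hU, Matrix.one_mul, Matrix.trace_mul_comm,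
        Matrix.mul_assoc, hW, Matrix.mul_one, Matrix.trace_diagonal]
    rw [h1, h2, hN, add_zero]
  · have hsplit : G - (U * Wᵀ + (1 - U * Uᵀ) * G * (1 - W * Wᵀ)) =
        (U * Uᵀ * G + (1 - U * Uᵀ) * (G * (W * Wᵀ))) + -(U * Wᵀ) := by
      simp only [Matrix.sub_mul, Matrix.mul_sub, Matrix.one_mul, Matrix.mul_one, Matrix.mul_assoc]
      abel
    have hUW : frobNorm (U * Wᵀ) = √A.rank := by
      rw [← hrk, ← frobNorm_mul_transpose_sq hU hW, Real.sqrt_sq (frobNorm_nonneg _)]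
    have hUU : frobNorm (U * Uᵀ) = √A.rank := by
      rw [← hrk, ← frobNorm_mul_transpose_sq hU hU, Real.sqrt_sq (frobNorm_nonneg _)]
    have hWW : frobNorm (W * Wᵀ) = √A.rank := by
      rw [← hrk, ← frobNorm_mul_transpose_sq hW hW, Real.sqrt_sq (frobNorm_nonneg _)]
    have h1 : frobNorm (U * Uᵀ * G) ≤ √A.rank := by
      refine (frobNorm_mul_le' _ _).trans ?_
      rw [hUU]
      exact mul_le_of_le_one_right (Real.sqrt_nonneg _) hG
    have h2 : frobNorm ((1 - U * Uᵀ) * (G * (W * Wᵀ))) ≤ √A.rank := by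
      refine (frobNorm_mul_le _ _).trans ?_
      refine (mul_le_of_le_one_left (frobNorm_nonneg _) (specNorm_compl_le_one hU)).trans ?_
      refine (frobNorm_mul_le _ _).trans ?_
      rw [hWW]
      exact mul_le_of_le_one_left (Real.sqrt_nonneg _) hG
    have horth : frobInner (U * Uᵀ * G) ((1 - U * Uᵀ) * (G * (W * Wᵀ))) = 0 := by
      rw [frobInner, Matrix.transpose_mul, Matrix.transpose_mul, Matrix.transpose_transpose,
        Matrix.mul_assoc, Matrix.mul_assoc, ← Matrix.mul_assoc Uᵀ, hUQ]
      simp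
    have h3 : frobNorm (U * Uᵀ * G + (1 - U * Uᵀ) * (G * (W * Wᵀ))) ≤ √2 * √A.rank := by
      apply le_of_sq_le_sq _ (by positivity)
      rw [frobNorm_add_sq, horth, mul_pow, Real.sq_sqrt zero_le_two]
      have e1 := pow_le_pow_left₀ (frobNorm_nonneg _) h1 2
      have e2 := pow_le_pow_left₀ (frobNorm_nonneg _) h2 2
      linarith
    rw [hsplit]
    refine (frobNorm_add_le _ _).trans ?_
    rw [frobNorm_neg, hUW]
    linarith

lemma nuclearNorm_add_smul_le (A B : Matrix m n ℝ) {a b : ℝ} (ha : 0 ≤ a) (hb : 0 ≤ b) :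
    nuclearNorm (a • A + b • B) ≤ a * nuclearNorm A + b * nuclearNorm B := by
  obtain ⟨V, hV, hVN, -⟩ := exists_subgradient_near (G := (0 : Matrix m n ℝ))
    (by rw [specNorm_zero]; exact zero_le_one) (a • A + b • B)
  rw [← hVN, frobInner_add_right, frobInner_smul_right, frobInner_smul_right]
  exact add_le_add (mul_le_mul_of_nonneg_left (frobInner_le_nuclearNorm hV A) ha)
    (mul_le_mul_of_nonneg_left (frobInner_le_nuclearNorm hV B) hb)

lemma nuclearNorm_nonneg (A : Matrix m n ℝ) : 0 ≤ nuclearNorm A :=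
  Finset.sum_nonneg fun l _ => LinearMap.singularValues_nonneg _ l

lemma nuclearNorm_zero : nuclearNorm (0 : Matrix m n ℝ) = 0 := by
  simp [nuclearNorm]

end Duality

section Oracle

variable {m n : Type*} [Fintype m] [Fintype n] [DecidableEq m] [DecidableEq n]
  {lam : ℝ} {Y Rhat : Matrix m n ℝ}

/-- The penalized least squares criterion is 2-strongly convex for the Frobenius norm, so it grows
quadratically away from its minimizer. -/
theorem IsPRLSSolution.quadratic_growth (hlam : 0 ≤ lam) (h : IsPRLSSolution lam Y Rhat)
    (R : Matrix m n ℝ) :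
    frobNorm (Y - Rhat) ^ 2 + lam * nuclearNorm Rhat + frobNorm (R - Rhat) ^ 2 ≤
      frobNorm (Y - R) ^ 2 + lam * nuclearNorm R := by
  set D := R - Rhat with hD
  have hR : Y - R = (Y - Rhat) - D := by rw [hD]; abel
  rw [hR, frobNorm_sub_sq (Y - Rhat)]
  suffices hs : 0 ≤ lam * (nuclearNorm R - nuclearNorm Rhat) - 2 * frobInner (Y - Rhat) D by
    linarith
  -- compare the minimizer with `(1 - s) Rhat + s R` and let `s` tend to zero
  have key : ∀ s : ℝ, 0 < s → s ≤ 1 →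
      0 ≤ lam * (nuclearNorm R - nuclearNorm Rhat) - 2 * frobInner (Y - Rhat) D +
        s * frobNorm D ^ 2 := by
    intro s hs0 hs1
    have h1 := isMinOn_iff.1 h ((1 - s) • Rhat + s • R) (Set.mem_univ _)
    have h2 := nuclearNorm_add_smul_le Rhat R (sub_nonneg.2 hs1) hs0.le
    have h3 : Y - ((1 - s) • Rhat + s • R) = (Y - Rhat) - s • D := by
      rw [hD, sub_smul, one_smul, smul_sub]; abel
    simp only [h3] at h1
    rw [frobNorm_sub_sq (Y - Rhat), frobInner_smul_right, frobNorm_smul, mul_pow, sq_abs] at h1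
    have h4 := mul_le_mul_of_nonneg_left h2 hlam
    have h5 : 0 ≤ s * (lam * (nuclearNorm R - nuclearNorm Rhat) - 2 * frobInner (Y - Rhat) D +
        s * frobNorm D ^ 2) := by nlinarith
    exact nonneg_of_mul_nonneg_right h5 hs0
  have hlim : Tendsto (fun s : ℝ => lam * (nuclearNorm R - nuclearNorm Rhat) -
      2 * frobInner (Y - Rhat) D + s * frobNorm D ^ 2) (𝓝[>] 0)
      (𝓝 (lam * (nuclearNorm R - nuclearNorm Rhat) - 2 * frobInner (Y - Rhat) D +
        0 * frobNorm D ^ 2)) := by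
    apply Tendsto.mono_left _ nhdsWithin_le_nhds
    exact (by fun_prop : Continuous fun s : ℝ => lam * (nuclearNorm R - nuclearNorm Rhat) -
      2 * frobInner (Y - Rhat) D + s * frobNorm D ^ 2).tendsto 0
  have := ge_of_tendsto hlim (by
    filter_upwards [Ioc_mem_nhdsGT (zero_lt_one' ℝ)] with s hs using key s hs.1 hs.2)
  linarith

/-- A nuclear norm penalized estimator satisfies a sharp oracle inequality as soon as the penalty
level dominates twice the spectral norm of the noise `Y - R₀`. -/
theorem IsPRLSSolution.oracle_inequality (h : IsPRLSSolution lam Y Rhat) {R₀ : Matrix m n ℝ}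
    (hnoise : specNorm (Y - R₀) ≤ lam / 2) (R : Matrix m n ℝ) :
    frobNorm (Rhat - R₀) ^ 2 ≤
      frobNorm (R - R₀) ^ 2 + ((1 + √2) * (lam / 2)) ^ 2 * R.rank := by
  have hlam : 0 ≤ lam := by linarith [specNorm_nonneg (Y - R₀)]
  obtain ⟨G, hG, hGE⟩ : ∃ G : Matrix m n ℝ, specNorm G ≤ 1 ∧ Y - R₀ = (lam / 2) • G := by
    rcases hlam.eq_or_lt with h0 | hpos
    · refine ⟨0, by rw [specNorm_zero]; exact zero_le_one, ?_⟩
      rw [smul_zero]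
      apply eq_zero_of_specNorm_eq_zero
      exact le_antisymm (by simpa [← h0] using hnoise) (specNorm_nonneg _)
    · refine ⟨(lam / 2)⁻¹ • (Y - R₀), ?_, ?_⟩
      · rw [specNorm_smul, abs_of_pos (by positivity)]
        exact inv_mul_le_one_of_le₀ hnoise (by positivity)
      · rw [smul_smul, mul_inv_cancel₀ (by positivity), one_smul]
  obtain ⟨V, hV, hVR, hVG⟩ := exists_subgradient_near hG R
  have hgrow := h.quadratic_growth hlam R
  have hVhat := frobInner_le_nuclearNorm hV Rhat
  have e1 : Y - Rhat = (lam / 2) • G - (Rhat - R₀) := by rw [← hGE]; abel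
  have e2 : Y - R = (lam / 2) • G - (R - R₀) := by rw [← hGE]; abel
  rw [e1, e2, frobNorm_sub_sq _ (Rhat - R₀), frobNorm_sub_sq _ (R - R₀), frobInner_smul_left, frobInner_smul_left] at hgrow
  have hGR : frobInner G (Rhat - R₀) - frobInner G (R - R₀) = frobInner G (Rhat - R) := by
    simp only [frobInner_sub_right]; ring
  have hVD : frobInner V (Rhat - R) ≤ nuclearNorm Rhat - nuclearNorm R := by
    rw [frobInner_sub_right, hVR]; linarith
  have hCS := frobInner_le (G - V) (Rhat - R)
  rw [frobInner_sub_left] at hCS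
  rw [frobNorm_sub_comm R Rhat] at hgrow
  set d := frobNorm (Rhat - R) with hd
  have hd0 : 0 ≤ d := frobNorm_nonneg _
  have h1 : frobInner G (Rhat - R) - frobInner V (Rhat - R) ≤ (1 + √2) * √R.rank * d :=
    hCS.trans (mul_le_mul_of_nonneg_right hVG hd0)
  have h2 : lam * (frobInner G (Rhat - R) - (nuclearNorm Rhat - nuclearNorm R)) ≤
      lam * ((1 + √2) * √R.rank * d) := mul_le_mul_of_nonneg_left (by linarith) hlam
  have h3 : ((1 + √2) * (lam / 2)) ^ 2 * R.rank = ((1 + √2) * (lam / 2) * √R.rank) ^ 2 := by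
    rw [mul_pow _ (√(R.rank : ℝ)), Real.sq_sqrt (Nat.cast_nonneg _)]
  rw [h3]
  have hGR' := congrArg (fun x => lam * x) hGR
  nlinarith [sq_nonneg ((1 + √2) * (lam / 2) * √R.rank - d)]

end Oracle

/-! ### Nets of the unit sphere -/

section Nets

variable {E : Type*} [NormedAddCommGroup E] [NormedSpace ℝ E] [FiniteDimensional ℝ E]

/-- Volume bound for separated subsets of the unit ball: the balls of radius `ε / 2` around the
points are disjoint and contained in the ball of radius `1 + ε / 2`. -/
theorem card_le_of_separated_unit {ε : ℝ} (hε : 0 < ε) (s : Finset E) (hs : ∀ c ∈ s, ‖c‖ ≤ 1)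
    (h : ∀ c ∈ s, ∀ d ∈ s, c ≠ d → ε ≤ ‖c - d‖) :
    (s.card : ℝ) ≤ (1 + 2 / ε) ^ Module.finrank ℝ E := by
  borelize E
  let μ : Measure E := Measure.addHaar
  have δpos : 0 < ε / 2 := by positivity
  have ρpos : 0 < 1 + ε / 2 := by positivity
  set A := ⋃ c ∈ s, Metric.ball (c : E) (ε / 2) with hA
  have D : Set.Pairwise (s : Set E) (Function.onFun Disjoint fun c => Metric.ball (c : E) (ε / 2)) := by
    rintro c hc d hd hcd
    apply Metric.ball_disjoint_ball
    rw [dist_eq_norm]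
    linarith [h c hc d hd hcd]
  have A_subset : A ⊆ Metric.ball (0 : E) (1 + ε / 2) := by
    refine Set.iUnion₂_subset fun x hx => ?_
    apply Metric.ball_subset_ball'
    rw [dist_zero_right]
    linarith [hs x hx]
  have I : (s.card : ENNReal) * ENNReal.ofReal ((ε / 2) ^ Module.finrank ℝ E) *
      μ (Metric.ball 0 1) ≤
      ENNReal.ofReal ((1 + ε / 2) ^ Module.finrank ℝ E) * μ (Metric.ball 0 1) :=
    calc
      _ = μ A := by
        rw [hA, measure_biUnion_finset D fun c _ => measurableSet_ball]
        simp only [μ.addHaar_ball_of_pos _ δpos]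
        simp only [Finset.sum_const, nsmul_eq_mul, mul_assoc]
      _ ≤ μ (Metric.ball (0 : E) (1 + ε / 2)) := measure_mono A_subset
      _ = _ := by simp only [μ.addHaar_ball_of_pos _ ρpos]
  have J : (s.card : ENNReal) * ENNReal.ofReal ((ε / 2) ^ Module.finrank ℝ E) ≤
      ENNReal.ofReal ((1 + ε / 2) ^ Module.finrank ℝ E) :=
    (ENNReal.mul_le_mul_iff_left (Metric.measure_ball_pos _ _ zero_lt_one).ne'
      measure_ball_lt_top.ne).1 I
  have K := ENNReal.toReal_le_of_le_ofReal (pow_nonneg ρpos.le _) J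
  rw [ENNReal.toReal_mul, ENNReal.toReal_natCast, ENNReal.toReal_ofReal (by positivity),
    ← le_div_iff₀ (by positivity), ← div_pow] at K
  have e : (1 + ε / 2) / (ε / 2) = 1 + 2 / ε := by field_simp; ring
  rwa [e] at K

/-- The unit sphere of a `d`-dimensional space has an `ε`-net with at most `(1 + 2 / ε) ^ d` points:
take a maximal `ε`-separated subset. -/
theorem exists_net_unitSphere (E : Type*) [NormedAddCommGroup E] [NormedSpace ℝ E]
    [FiniteDimensional ℝ E] {ε : ℝ} (hε : 0 < ε) :
    ∃ N : Finset E, (∀ x ∈ N, ‖x‖ = 1) ∧ (∀ x, ‖x‖ = 1 → ∃ y ∈ N, ‖x - y‖ ≤ ε) ∧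
      (N.card : ℝ) ≤ (1 + 2 / ε) ^ Module.finrank ℝ E := by
  classical
  let Sep : Finset E → Prop := fun s =>
    (∀ c ∈ s, ‖c‖ = 1) ∧ ∀ c ∈ s, ∀ d ∈ s, c ≠ d → ε ≤ ‖c - d‖
  have hcard : ∀ s, Sep s → (s.card : ℝ) ≤ (1 + 2 / ε) ^ Module.finrank ℝ E := fun s hs =>
    card_le_of_separated_unit hε s (fun c hc => (hs.1 c hc).le) hs.2
  let C : Set ℕ := {k | ∃ s, Sep s ∧ s.card = k}
  have hne : C.Nonempty := ⟨0, ∅, ⟨by simp, by simp⟩, rfl⟩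
  have hbdd : BddAbove C := by
    refine ⟨⌊(1 + 2 / ε) ^ Module.finrank ℝ E⌋₊, ?_⟩
    rintro _ ⟨s, hs, rfl⟩
    exact Nat.le_floor (hcard s hs)
  obtain ⟨N, hN, hmax⟩ := Nat.sSup_mem hne hbdd
  refine ⟨N, hN.1, fun x hx => ?_, hcard N hN⟩
  by_contra! hfar
  have hxN : x ∉ N := fun hx' => by
    have := hfar x hx'
    rw [sub_self, norm_zero] at this
    exact absurd this (not_lt.2 hε.le)
  have hins : Sep (insert x N) := by
    refine ⟨?_, ?_⟩
    · intro c hc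
      rcases Finset.mem_insert.1 hc with rfl | hc
      · exact hx
      · exact hN.1 c hc
    · intro c hc d hd hcd
      rcases Finset.mem_insert.1 hc with rfl | hc <;> rcases Finset.mem_insert.1 hd with rfl | hd
      · exact absurd rfl hcd
      · exact (hfar d hd).le
      · rw [norm_sub_rev]; exact (hfar c ((Finset.mem_insert.1 hc).resolve_left hcd)).le
      · exact hN.2 c hc d hd hcd
  have hle : (insert x N).card ≤ sSup C := le_csSup hbdd ⟨_, hins, rfl⟩
  rw [Finset.card_insert_of_notMem hxN, hmax] at hle
  omega

end Nets

section SpecNormNet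

variable {m n : Type*} [Fintype m] [Fintype n] [DecidableEq n]

/-- The spectral norm is controlled by the values of the bilinear form on nets of the two unit
spheres. -/
theorem specNorm_le_of_net {A : Matrix m n ℝ} {ε c : ℝ} (hε₀ : 0 ≤ ε) (hε : ε < 1 / 2) (hc : 0 ≤ c)
    {N₁ : Finset (EuclideanSpace ℝ m)} {N₂ : Finset (EuclideanSpace ℝ n)}
    (h₁ : ∀ x ∈ N₁, ‖x‖ = 1) (hN₁ : ∀ x, ‖x‖ = 1 → ∃ y ∈ N₁, ‖x - y‖ ≤ ε)
    (hN₂ : ∀ x, ‖x‖ = 1 → ∃ y ∈ N₂, ‖x - y‖ ≤ ε)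
    (h : ∀ x ∈ N₁, ∀ y ∈ N₂, inner ℝ x (Matrix.toEuclideanLin A y) ≤ c) :
    specNorm A ≤ c / (1 - 2 * ε) := by
  set T := Matrix.toEuclideanLin A with hT
  set σ := specNorm A with hσ
  have hσ0 : 0 ≤ σ := specNorm_nonneg A
  have hbil : ∀ x y, inner ℝ x (T y) ≤ ‖x‖ * (σ * ‖y‖) := fun x y =>
    (real_inner_le_norm _ _).trans
      (mul_le_mul_of_nonneg_left (norm_toEuclideanLin_le A y) (norm_nonneg x))
  have hunit : ∀ x y, ‖x‖ = 1 → ‖y‖ = 1 → inner ℝ x (T y) ≤ c + 2 * ε * σ := by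
    intro x y hx hy
    obtain ⟨x₀, hx₀, hxx⟩ := hN₁ x hx
    obtain ⟨y₀, hy₀, hyy⟩ := hN₂ y hy
    have e : inner ℝ x (T y) = inner ℝ x₀ (T y₀) + inner ℝ (x - x₀) (T y) +
        inner ℝ x₀ (T (y - y₀)) := by
      rw [map_sub, inner_sub_left, inner_sub_right]; ring
    have b1 := hbil (x - x₀) y
    have b2 := hbil x₀ (y - y₀)
    rw [hy, mul_one] at b1
    rw [h₁ x₀ hx₀, one_mul] at b2
    have b3 := mul_le_mul_of_nonneg_right hxx hσ0
    have b4 := mul_le_mul_of_nonneg_left hyy hσ0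
    rw [e]
    linarith [h x₀ hx₀ y₀ hy₀]
  have hσle : σ ≤ c + 2 * ε * σ := by
    refine specNorm_le_of_forall (by positivity) fun y => ?_
    rw [← hT]
    by_cases hTy : T y = 0
    · rw [hTy, norm_zero]; positivity
    have hy : y ≠ 0 := fun h0 => hTy (by rw [h0, map_zero])
    have hyn : 0 < ‖y‖ := norm_pos_iff.2 hy
    have hTn : 0 < ‖T y‖ := norm_pos_iff.2 hTy
    have hb := hunit (‖T y‖⁻¹ • T y) (‖y‖⁻¹ • y)
      (by rw [norm_smul, norm_inv, norm_norm, inv_mul_cancel₀ hTn.ne'])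
      (by rw [norm_smul, norm_inv, norm_norm, inv_mul_cancel₀ hyn.ne'])
    rw [map_smul, inner_smul_left, inner_smul_right, real_inner_self_eq_norm_sq] at hb
    have e : (starRingEnd ℝ) ‖T y‖⁻¹ * (‖y‖⁻¹ * ‖T y‖ ^ 2) = ‖T y‖ / ‖y‖ := by
      rw [conj_trivial]; field_simp
    rwa [e, div_le_iff₀ hyn] at hb
  rw [le_div_iff₀ (by linarith)]
  linarith

end SpecNormNet

/-! ### Moment generating functions of Gaussian quadratic forms -/

section ChiSquare

lemma mgf_sq_sub_one_gaussianReal {θ : ℝ} (hθ : θ < 1 / 2) :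
    mgf (fun x => x ^ 2 - 1) (gaussianReal 0 1) θ = Real.exp (-θ) * (√(1 - 2 * θ))⁻¹ := by
  have hpos : 0 < 1 - 2 * θ := by linarith
  rw [mgf, integral_gaussianReal_eq_integral_smul one_ne_zero]
  have e : ∀ x : ℝ, gaussianPDFReal 0 1 x • Real.exp (θ * (x ^ 2 - 1)) =
      ((√(2 * Real.pi))⁻¹ * Real.exp (-θ)) * Real.exp (-(1 / 2 - θ) * x ^ 2) := by
    intro x
    rw [gaussianPDFReal_def, smul_eq_mul, mul_assoc, mul_assoc]
    simp only [NNReal.coe_one, mul_one, sub_zero]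
    rw [← Real.exp_add, mul_assoc, ← Real.exp_add]
    congr 2
    ring
  simp_rw [e]
  rw [integral_const_mul, integral_gaussian]
  have e2 : Real.pi / (1 / 2 - θ) = 2 * Real.pi / (1 - 2 * θ) := by
    have : 1 / 2 - θ ≠ 0 := by linarith
    field_simp
  rw [e2, Real.sqrt_div (by positivity)]
  have h1 : √(2 * Real.pi) ≠ 0 := by positivity
  have h2 : √(1 - 2 * θ) ≠ 0 := by positivity
  field_simp

/-- The logarithmic estimate `-log (1 - u) ≤ u + u² / (2 (1 - |u|))`. For `u ≥ 0` it is
`x ≤ sinh x` at `x = -log (1 - u)`. -/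
lemma neg_log_one_sub_le {u : ℝ} (hu : |u| < 1) :
    -Real.log (1 - u) ≤ u + u ^ 2 / (2 * (1 - |u|)) := by
  rcases le_total 0 u with h0 | h0
  · rw [abs_of_nonneg h0] at hu ⊢
    have hpos : 0 < 1 - u := by linarith
    have h := Real.self_le_sinh_iff.2 (show 0 ≤ -Real.log (1 - u) by linarith [Real.log_nonpos hpos.le (by linarith)])
    rw [Real.sinh_eq, neg_neg, Real.exp_neg, Real.exp_log hpos] at h
    refine h.trans (le_of_eq ?_)
    field_simp
    ring
  · obtain ⟨v, rfl⟩ : ∃ v, u = -v := ⟨-u, by ring⟩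
    have hv : 0 ≤ v := by linarith
    rw [abs_neg, abs_of_nonneg hv] at hu ⊢
    have h := Real.le_log_one_add_of_nonneg hv
    have h1 : v - v ^ 2 / 2 ≤ 2 * v / (v + 2) := by
      rw [le_div_iff₀ (by linarith)]
      nlinarith [pow_nonneg hv 3]
    have h2 : v ^ 2 / 2 ≤ v ^ 2 / (2 * (1 - v)) := by
      apply div_le_div_of_nonneg_left (by positivity) (by linarith) (by linarith)
    rw [sub_neg_eq_add, neg_sq]
    linarith

lemma mgf_sq_sub_one_gaussianReal_le {θ : ℝ} (hθ : |θ| < 1 / 2) :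
    mgf (fun x => x ^ 2 - 1) (gaussianReal 0 1) θ ≤ Real.exp (θ ^ 2 / (1 - 2 * |θ|)) := by
  have hθ' : θ < 1 / 2 := (le_abs_self θ).trans_lt hθ
  have hpos : 0 < 1 - 2 * θ := by linarith
  rw [mgf_sq_sub_one_gaussianReal hθ']
  have e : (√(1 - 2 * θ))⁻¹ = Real.exp (-Real.log (1 - 2 * θ) / 2) := by
    rw [neg_div, Real.exp_neg, ← Real.log_sqrt hpos.le, Real.exp_log (by positivity)]
  have habs : |2 * θ| = 2 * |θ| := by rw [abs_mul, abs_two]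
  have h := neg_log_one_sub_le (u := 2 * θ) (by rw [habs]; linarith)
  rw [habs] at h
  rw [e, ← Real.exp_add]
  apply Real.exp_le_exp.2
  have e2 : (2 * θ) ^ 2 / (2 * (1 - 2 * |θ|)) = 2 * (θ ^ 2 / (1 - 2 * |θ|)) := by
    have : 1 - 2 * |θ| ≠ 0 := by linarith
    field_simp
  rw [e2] at h
  linarith

variable {ι : Type*} [Fintype ι]

lemma mgf_diagonal_gaussian (a : ι → ℝ) (θ : ℝ) :
    mgf (fun x : ι → ℝ => ∑ i, a i * (x i ^ 2 - 1)) (Measure.pi fun _ => gaussianReal 0 1) θ =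
      ∏ i, mgf (fun x => x ^ 2 - 1) (gaussianReal 0 1) (θ * a i) := by
  simp only [mgf]
  rw [← integral_fintype_prod_eq_prod (μ := fun _ : ι => gaussianReal 0 1)
    (fun i x => Real.exp (θ * a i * (x ^ 2 - 1)))]
  congr 1
  ext x
  rw [← Real.exp_sum, Finset.mul_sum]
  simp only [mul_assoc]

lemma mgf_diagonal_gaussian_bound {a : ι → ℝ} {C θ : ℝ} (hC : 0 ≤ C) (ha : ∑ i, a i ^ 2 ≤ C ^ 2)
    (hθ : |θ| * C < 1 / 2) :
    0 < mgf (fun x : ι → ℝ => ∑ i, a i * (x i ^ 2 - 1))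
        (Measure.pi fun _ => gaussianReal 0 1) θ ∧
    mgf (fun x : ι → ℝ => ∑ i, a i * (x i ^ 2 - 1)) (Measure.pi fun _ => gaussianReal 0 1) θ ≤
      Real.exp (θ ^ 2 * C ^ 2 / (1 - 2 * (|θ| * C))) := by
  rw [mgf_diagonal_gaussian]
  have hden : 0 < 1 - 2 * (|θ| * C) := by linarith
  have habs : ∀ i, |θ * a i| ≤ |θ| * C := by
    intro i
    rw [abs_mul]
    refine mul_le_mul_of_nonneg_left ?_ (abs_nonneg θ)
    apply abs_le_of_sq_le_sq _ hC
    exact (Finset.single_le_sum (f := fun i => a i ^ 2) (fun j _ => sq_nonneg (a j))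
      (Finset.mem_univ i)).trans ha
  constructor
  · refine Finset.prod_pos fun i _ => ?_
    have h1 : θ * a i < 1 / 2 := ((le_abs_self _).trans (habs i)).trans_lt hθ
    rw [mgf_sq_sub_one_gaussianReal h1]
    have : 0 < 1 - 2 * (θ * a i) := by linarith
    positivity
  · calc ∏ i, mgf (fun x => x ^ 2 - 1) (gaussianReal 0 1) (θ * a i)
        ≤ ∏ i, Real.exp (θ ^ 2 * a i ^ 2 / (1 - 2 * (|θ| * C))) := by
          refine Finset.prod_le_prod (fun i _ => mgf_nonneg) fun i _ => ?_
          refine (mgf_sq_sub_one_gaussianReal_le ((habs i).trans_lt hθ)).trans ?_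
          apply Real.exp_le_exp.2
          rw [mul_pow]
          exact div_le_div_of_nonneg_left (by positivity) hden (by linarith [habs i])
      _ = Real.exp (θ ^ 2 * (∑ i, a i ^ 2) / (1 - 2 * (|θ| * C))) := by
          rw [← Real.exp_sum, ← Finset.sum_div, Finset.mul_sum]
      _ ≤ _ := by
          apply Real.exp_le_exp.2
          gcongr

end ChiSquare

section QuadraticForm

variable {ι : Type*} [Fintype ι] [DecidableEq ι]

lemma trace_eq_sum_dotProduct (A : Matrix ι ι ℝ)
    (b : OrthonormalBasis ι ℝ (EuclideanSpace ℝ ι)) :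
    A.trace = ∑ i, (b i).ofLp ⬝ᵥ (A *ᵥ (b i).ofLp) := by
  have h := LinearMap.trace_eq_sum_inner (Matrix.toEuclideanLin A) b
  rw [Matrix.toEuclideanLin_eq_toLin_orthonormal, Matrix.trace_toLin_eq,
    ← Matrix.toEuclideanLin_eq_toLin_orthonormal] at h
  rw [h]
  refine Finset.sum_congr rfl fun i _ => ?_
  rw [EuclideanSpace.inner_eq_star_dotProduct, star_trivial, dotProduct_comm]
  rfl

lemma sum_sq_eigenvalues {A : Matrix ι ι ℝ} (hA : A.IsHermitian) :
    ∑ i, hA.eigenvalues i ^ 2 = frobNorm A ^ 2 := by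
  rw [← frobInner_self, frobInner]
  have hAt : Aᵀ = A := by rw [← Matrix.conjTranspose_eq_transpose_of_trivial]; exact hA
  rw [hAt, trace_eq_sum_dotProduct (A * A) hA.eigenvectorBasis]
  refine Finset.sum_congr rfl fun i _ => ?_
  have hb : (hA.eigenvectorBasis i).ofLp ⬝ᵥ (hA.eigenvectorBasis i).ofLp = 1 := by
    rw [← norm_toLp_sq]
    change ‖hA.eigenvectorBasis i‖ ^ 2 = 1
    rw [hA.eigenvectorBasis.norm_eq_one, one_pow]
  rw [← Matrix.mulVec_mulVec, hA.mulVec_eigenvectorBasis, Matrix.mulVec_smul,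
    hA.mulVec_eigenvectorBasis, dotProduct_smul, dotProduct_smul, hb]
  simp [sq]

/-- Moment generating function of a centred quadratic form in a standard Gaussian vector: in an
eigenbasis the form is a combination of independent centred chi-square variables. -/
lemma mgf_quadForm_stdGaussian_bound {A : Matrix ι ι ℝ} (hA : A.IsHermitian) {C θ : ℝ} (hC : 0 ≤ C)
    (hAC : frobNorm A ≤ C) (hθ : |θ| * C < 1 / 2) :
    0 < mgf (fun g => g.ofLp ⬝ᵥ (A *ᵥ g.ofLp) - A.trace) (stdGaussian (EuclideanSpace ℝ ι)) θ ∧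
    mgf (fun g => g.ofLp ⬝ᵥ (A *ᵥ g.ofLp) - A.trace) (stdGaussian (EuclideanSpace ℝ ι)) θ ≤
      Real.exp (θ ^ 2 * C ^ 2 / (1 - 2 * (|θ| * C))) := by
  set b := hA.eigenvectorBasis with hb
  have hcomp : (fun g : EuclideanSpace ℝ ι => g.ofLp ⬝ᵥ (A *ᵥ g.ofLp) - A.trace) ∘
      (fun x : ι → ℝ => ∑ i, x i • b i) = fun x => ∑ i, hA.eigenvalues i * (x i ^ 2 - 1) := by
    ext x
    simp only [Function.comp_apply]
    have h1 : (∑ i, x i • b i).ofLp ⬝ᵥ (A *ᵥ (∑ i, x i • b i).ofLp) =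
        inner ℝ (∑ i, x i • b i) (∑ i, (hA.eigenvalues i * x i) • b i) := by
      rw [EuclideanSpace.inner_eq_star_dotProduct, star_trivial, dotProduct_comm]
      congr 1
      rw [WithLp.ofLp_sum, WithLp.ofLp_sum, Matrix.mulVec_sum]
      refine Finset.sum_congr rfl fun i _ => ?_
      rw [WithLp.ofLp_smul, WithLp.ofLp_smul, Matrix.mulVec_smul, hb, hA.mulVec_eigenvectorBasis,
        smul_smul, mul_comm]
    rw [h1, b.orthonormal.inner_sum, hA.trace_eq_sum_eigenvalues, ← Finset.sum_sub_distrib]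
    refine Finset.sum_congr rfl fun i _ => ?_
    simp only [conj_trivial, RCLike.ofReal_real_eq_id, id]
    ring
  have hmgf : mgf (fun g => g.ofLp ⬝ᵥ (A *ᵥ g.ofLp) - A.trace)
      (stdGaussian (EuclideanSpace ℝ ι)) θ =
      mgf (fun x : ι → ℝ => ∑ i, hA.eigenvalues i * (x i ^ 2 - 1))
        (Measure.pi fun _ => gaussianReal 0 1) θ := by
    rw [stdGaussian_eq_map_pi_orthonormalBasis b, mgf_map (Measurable.aemeasurable (by fun_prop)), hcomp]
    apply Continuous.aestronglyMeasurable
    unfold dotProduct Matrix.mulVec dotProduct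
    fun_prop
  rw [hmgf]
  apply mgf_diagonal_gaussian_bound hC _ hθ
  rw [sum_sq_eigenvalues]
  exact pow_le_pow_left₀ (frobNorm_nonneg A) hAC 2

open scoped MatrixOrder in
/-- A positive semidefinite matrix has a symmetric square root representing the multivariate
Gaussian law. -/
lemma exists_sqrt_multivariateGaussian {S : Matrix ι ι ℝ} (hS : S.PosSemidef) :
    ∃ T : Matrix ι ι ℝ, Tᵀ = T ∧ T * T = S ∧ specNorm T ^ 2 = specNorm S ∧
      multivariateGaussian 0 S =
        (stdGaussian (EuclideanSpace ℝ ι)).map fun g => WithLp.toLp 2 (T *ᵥ g.ofLp) := by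
  have hTT : CFC.sqrt S * CFC.sqrt S = S := CFC.sqrt_mul_sqrt_self S hS.nonneg
  have hT : (CFC.sqrt S)ᴴ = CFC.sqrt S := (CFC.sqrt_nonneg S).isSelfAdjoint
  refine ⟨CFC.sqrt S, ?_, hTT, ?_, ?_⟩
  · rwa [Matrix.conjTranspose_eq_transpose_of_trivial] at hT
  · have h := Matrix.l2_opNorm_conjTranspose_mul_self (CFC.sqrt S)
    rw [hT, hTT] at h
    rw [sq]
    exact h.symm
  · rw [multivariateGaussian]
    congr 1
    ext g
    rw [zero_add, Matrix.ofLp_toEuclideanCLM]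

/-- Moment generating function of the centred quadratic form `zᵀ K z` of a Gaussian vector with
covariance `S`, when `K` has Frobenius norm at most one. -/
theorem mgf_quadForm_multivariateGaussian_bound {S K : Matrix ι ι ℝ} (hS : S.PosSemidef)
    (hK : frobNorm K ≤ 1) {θ : ℝ} (hθ : |θ| * specNorm S < 1 / 2) :
    0 < mgf (fun z => z.ofLp ⬝ᵥ (K *ᵥ z.ofLp) - frobInner S K) (multivariateGaussian 0 S) θ ∧
    mgf (fun z => z.ofLp ⬝ᵥ (K *ᵥ z.ofLp) - frobInner S K) (multivariateGaussian 0 S) θ ≤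
      Real.exp (θ ^ 2 * specNorm S ^ 2 / (1 - 2 * (|θ| * specNorm S))) := by
  obtain ⟨T, hT, hTT, hTn, hlaw⟩ := exists_sqrt_multivariateGaussian hS
  -- only the symmetric part of `K` matters for the quadratic form
  set L : Matrix ι ι ℝ := (1 / 2 : ℝ) • (K + Kᵀ) with hL
  have hLt : Lᵀ = L := by
    rw [hL, Matrix.transpose_smul, Matrix.transpose_add, Matrix.transpose_transpose, add_comm]
  have hLn : frobNorm L ≤ 1 := by
    rw [hL, frobNorm_smul, abs_of_pos (by norm_num)]
    have := frobNorm_add_le K Kᵀ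
    rw [frobNorm_transpose] at this
    linarith
  have hSt : Sᵀ = S := by rw [← Matrix.conjTranspose_eq_transpose_of_trivial]; exact hS.1
  set A := T * L * T with hA
  have hAh : A.IsHermitian := by
    rw [Matrix.IsHermitian, Matrix.conjTranspose_eq_transpose_of_trivial, hA, Matrix.transpose_mul,
      Matrix.transpose_mul, hT, hLt, Matrix.mul_assoc]
  have hAn : frobNorm A ≤ specNorm S := by
    refine (frobNorm_mul_le' _ _).trans ?_
    refine (mul_le_mul_of_nonneg_right (frobNorm_mul_le T L) (specNorm_nonneg T)).trans ?_
    rw [← hTn, sq]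
    exact mul_le_mul_of_nonneg_right (mul_le_of_le_one_right (specNorm_nonneg T) hLn)
      (specNorm_nonneg T)
  have htr : A.trace = frobInner S K := by
    rw [hA, Matrix.mul_assoc, Matrix.trace_mul_comm, Matrix.mul_assoc, hTT, Matrix.trace_mul_comm,
      frobInner, hSt, hL, Matrix.mul_smul, Matrix.mul_add, Matrix.trace_smul, Matrix.trace_add]
    have : (S * Kᵀ).trace = (S * K).trace := by
      rw [← Matrix.trace_transpose, Matrix.transpose_mul, Matrix.transpose_transpose, hSt,
        Matrix.trace_mul_comm]
    rw [this, smul_eq_mul]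
    ring
  have hquad : ∀ x : ι → ℝ, x ⬝ᵥ (K *ᵥ x) = x ⬝ᵥ (L *ᵥ x) := by
    intro x
    have : x ⬝ᵥ (Kᵀ *ᵥ x) = x ⬝ᵥ (K *ᵥ x) := by
      rw [← mulVec_dotProduct_eq, dotProduct_comm]
    rw [hL, Matrix.smul_mulVec, Matrix.add_mulVec, dotProduct_smul, dotProduct_add, this,
      smul_eq_mul]
    ring
  have hmgf : mgf (fun z => z.ofLp ⬝ᵥ (K *ᵥ z.ofLp) - frobInner S K)
      (multivariateGaussian 0 S) θ =
      mgf (fun g => g.ofLp ⬝ᵥ (A *ᵥ g.ofLp) - A.trace) (stdGaussian (EuclideanSpace ℝ ι)) θ := by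
    rw [hlaw, mgf_map]
    · congr 1
      ext g
      simp only [Function.comp_apply]
      rw [hquad, htr, mulVec_dotProduct_eq, hT, Matrix.mulVec_mulVec, Matrix.mulVec_mulVec, hA]
    · apply Continuous.aemeasurable
      unfold Matrix.mulVec dotProduct
      fun_prop
    · apply Continuous.aestronglyMeasurable
      unfold dotProduct Matrix.mulVec dotProduct
      fun_prop
  rw [hmgf]
  exact mgf_quadForm_stdGaussian_bound hAh (specNorm_nonneg S) hAn hθ

end QuadraticForm

/-! ### Tail bound for averages of Gaussian quadratic forms -/

section Tail

variable {Ω ι : Type*} [MeasurableSpace Ω] [Fintype ι] {P : Measure Ω}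
  {S K : Matrix ι ι ℝ} {n : ℕ} {z : Fin n → Ω → EuclideanSpace ℝ ι}

lemma continuous_quadForm (K : Matrix ι ι ℝ) (c : ℝ) :
    Continuous fun x : EuclideanSpace ℝ ι => x.ofLp ⬝ᵥ (K *ᵥ x.ofLp) - c := by
  unfold dotProduct Matrix.mulVec dotProduct
  fun_prop

variable [DecidableEq ι]

lemma ae_eq_zero_of_hasLaw_multivariateGaussian_zero {X : Ω → EuclideanSpace ℝ ι}
    (hX : HasLaw X (multivariateGaussian 0 (0 : Matrix ι ι ℝ)) P) : ∀ᵐ ω ∂P, X ω = 0 := by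
  have hdirac : multivariateGaussian 0 (0 : Matrix ι ι ℝ) = Measure.dirac 0 := by
    obtain ⟨T, -, -, hT, hlaw⟩ := exists_sqrt_multivariateGaussian (Matrix.PosSemidef.zero (n := ι)
      (R := ℝ))
    rw [specNorm_zero, sq_eq_zero_iff] at hT
    rw [hlaw, eq_zero_of_specNorm_eq_zero hT]
    simp
  rw [hdirac] at hX
  refine ae_of_ae_map (p := fun y => y = 0) hX.aemeasurable ?_
  rw [hX.map_eq]
  simp

/-- Bernstein-type upper tail bound for the empirical average of a quadratic form of Frobenius norm
at most one in i.i.d. Gaussian vectors. -/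
theorem IsIIDGaussian.measureReal_quadForm_gt_le [IsProbabilityMeasure P] (hS : S.PosSemidef)
    (hz : IsIIDGaussian P S z) (hn : 1 ≤ n) (hK : frobNorm K ≤ 1) {u : ℝ} (hu : 0 ≤ u) :
    P.real {ω | specNorm S * u < (1 / (n : ℝ)) *
        ∑ s, ((z s ω).ofLp ⬝ᵥ (K *ᵥ (z s ω).ofLp) - frobInner S K)} ≤
      Real.exp (-(n * u ^ 2 / (4 * (1 + u)))) := by
  have hn0 : (0 : ℝ) < n := by exact_mod_cast hn
  rcases (specNorm_nonneg S).eq_or_lt with h0 | hC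
  -- in the degenerate case `S = 0` the Chernoff exponent below would be divided by zero
  · have hS0 := eq_zero_of_specNorm_eq_zero h0.symm
    subst hS0
    have hz0 : ∀ᵐ ω ∂P, ∀ s, z s ω = 0 :=
      ae_all_iff.2 fun s => ae_eq_zero_of_hasLaw_multivariateGaussian_zero (hz.2 s)
    have hnull : P {ω | specNorm (0 : Matrix ι ι ℝ) * u < (1 / (n : ℝ)) *
        ∑ s, ((z s ω).ofLp ⬝ᵥ (K *ᵥ (z s ω).ofLp) - frobInner 0 K)} = 0 := by
      refine measure_mono_null ?_ (ae_iff.1 hz0)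
      intro ω hω h
      simp [specNorm_zero, frobInner, h] at hω
    rw [measureReal_def, hnull, ENNReal.toReal_zero]
    positivity
  · set C := specNorm S with hCdef
    set f : EuclideanSpace ℝ ι → ℝ := fun x => x.ofLp ⬝ᵥ (K *ᵥ x.ofLp) - frobInner S K with hf
    have hfm : Measurable f := (continuous_quadForm K _).measurable
    -- the optimal Chernoff exponent
    set θ : ℝ := u / (2 * (1 + u)) / C with hθ
    have hu1 : 0 < 1 + u := by linarith
    have hθ0 : 0 ≤ θ := by positivity
    have hθC : |θ| * C = u / (2 * (1 + u)) := by
      rw [abs_of_nonneg hθ0, hθ]; field_simp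
    have hθlt : |θ| * C < 1 / 2 := by
      rw [hθC, div_lt_div_iff₀ (by positivity) (by norm_num)]
      linarith
    have hind : iIndepFun (fun s => f ∘ z s) P := hz.1.comp (fun _ => f) fun _ => hfm
    have hmeas : ∀ s, AEMeasurable (f ∘ z s) P := fun s =>
      hfm.comp_aemeasurable (hz.2 s).aemeasurable
    have hmgf : ∀ s, mgf (f ∘ z s) P θ = mgf f (multivariateGaussian 0 S) θ := fun s => by
      rw [← (hz.2 s).map_eq, mgf_map (hz.2 s).aemeasurable]
      exact (by fun_prop : Measurable fun x => Real.exp (θ * f x)).aestronglyMeasurable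
    obtain ⟨hpos, hle⟩ := mgf_quadForm_multivariateGaussian_bound hS hK hθlt
    have hsum := hind.mgf_sum₀ (t := θ) hmeas Finset.univ
    simp only [hmgf, Finset.prod_const, Finset.card_univ, Fintype.card_fin] at hsum
    have hint : Integrable (fun ω => Real.exp (θ * (∑ s, f ∘ z s) ω)) P := by
      rw [← mgf_pos_iff, hsum]
      exact pow_pos hpos n
    have hch := measure_ge_le_exp_mul_mgf (μ := P) (n * (C * u)) hθ0 hint
    have hsub : {ω | C * u < (1 / (n : ℝ)) *
        ∑ s, ((z s ω).ofLp ⬝ᵥ (K *ᵥ (z s ω).ofLp) - frobInner S K)} ⊆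
        {ω | n * (C * u) ≤ (∑ s, f ∘ z s) ω} := by
      intro ω hω
      simp only [Set.mem_ofPred_eq] at hω ⊢
      rw [one_div, inv_mul_eq_div, lt_div_iff₀ hn0] at hω
      rw [Finset.sum_apply, mul_comm (n : ℝ)]
      exact hω.le
    refine (measureReal_mono hsub).trans (hch.trans ?_)
    rw [hsum]
    refine (mul_le_mul_of_nonneg_left (pow_le_pow_left₀ hpos.le hle n) (Real.exp_nonneg _)).trans ?_
    rw [← Real.exp_nat_mul, ← Real.exp_add]
    apply Real.exp_le_exp.2
    apply le_of_eq
    have e1 : θ ^ 2 * C ^ 2 = (u / (2 * (1 + u))) ^ 2 := by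
      rw [← hθC, mul_pow, sq_abs]
    have e2 : 1 - 2 * (u / (2 * (1 + u))) = 1 / (1 + u) := by field_simp; ring
    have e3 : θ * C = u / (2 * (1 + u)) := by rw [← hθC, abs_of_nonneg hθ0]
    rw [← hCdef, hθC, e1, e2]
    have e4 : -θ * (n * (C * u)) = -(n * u * (θ * C)) := by ring
    rw [e4, e3]
    field_simp
    ring

end Tail

/-! ### Bilinear forms of the rearranged sample covariance -/

section Rearrangement

variable {p q : ℕ}

/-- The rank-one functional `R ↦ xᵀ R y` of the rearranged matrix, as a matrix paired with the
original one: it is the Kronecker product of the matrices with entries `x` and `y`. -/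
def kronOf (x : EuclideanSpace ℝ (Fin p × Fin p)) (y : EuclideanSpace ℝ (Fin q × Fin q)) :
    Matrix (Fin p × Fin q) (Fin p × Fin q) ℝ :=
  Matrix.of fun a b => x (a.1, b.1) * y (a.2, b.2)

lemma inner_rearrange (S : Matrix (Fin p × Fin q) (Fin p × Fin q) ℝ)
    (x : EuclideanSpace ℝ (Fin p × Fin p)) (y : EuclideanSpace ℝ (Fin q × Fin q)) :
    inner ℝ x (Matrix.toEuclideanLin (rearrange p q S) y) = frobInner S (kronOf x y) := by
  have h1 : inner ℝ x (Matrix.toEuclideanLin (rearrange p q S) y) =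
      ∑ ij : Fin p × Fin p, ∑ kl : Fin q × Fin q,
        x ij * (S (ij.1, kl.1) (ij.2, kl.2) * y kl) := by
    rw [PiLp.inner_apply]
    refine Finset.sum_congr rfl fun ij _ => ?_
    rw [← Finset.mul_sum, RCLike.inner_apply, conj_trivial, mul_comm]
    rfl
  rw [h1, frobInner_eq_sum]
  simp only [Fintype.sum_prod_type, kronOf, Matrix.of_apply]
  refine Finset.sum_congr rfl fun i _ => ?_
  rw [Finset.sum_comm]
  refine Finset.sum_congr rfl fun k _ => ?_
  refine Finset.sum_congr rfl fun j _ => ?_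
  refine Finset.sum_congr rfl fun l _ => ?_
  ring

lemma frobNorm_kronOf (x : EuclideanSpace ℝ (Fin p × Fin p)) (y : EuclideanSpace ℝ (Fin q × Fin q)) :
    frobNorm (kronOf x y) = ‖x‖ * ‖y‖ := by
  rw [← sq_eq_sq₀ (frobNorm_nonneg _) (by positivity), mul_pow, frobNorm_sq,
    EuclideanSpace.real_norm_sq_eq, EuclideanSpace.real_norm_sq_eq, Finset.sum_mul_sum]
  simp only [Fintype.sum_prod_type, kronOf, Matrix.of_apply, mul_pow]
  refine Finset.sum_congr rfl fun i _ => ?_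
  rw [Finset.sum_comm]

lemma frobInner_sampleCov {ι : Type*} [Fintype ι] {n : ℕ} (z : Fin n → EuclideanSpace ℝ ι)
    (K : Matrix ι ι ℝ) :
    frobInner (sampleCov z) K = (1 / (n : ℝ)) * ∑ s, (z s).ofLp ⬝ᵥ (K *ᵥ (z s).ofLp) := by
  rw [sampleCov, frobInner_smul_left, frobInner, Matrix.transpose_sum, Matrix.sum_mul,
    Matrix.trace_sum]
  congr 1
  refine Finset.sum_congr rfl fun s _ => ?_
  change frobInner (Matrix.vecMulVec (z s) (z s)) K = _
  rw [frobInner_eq_sum]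
  simp only [Matrix.vecMulVec_apply, dotProduct, Matrix.mulVec, Finset.mul_sum]
  refine Finset.sum_congr rfl fun i _ => Finset.sum_congr rfl fun j _ => ?_
  ring

lemma inner_rearrange_sampleCov_sub {n : ℕ} (hn : 1 ≤ n)
    (z : Fin n → EuclideanSpace ℝ (Fin p × Fin q))
    (S : Matrix (Fin p × Fin q) (Fin p × Fin q) ℝ)
    (x : EuclideanSpace ℝ (Fin p × Fin p)) (y : EuclideanSpace ℝ (Fin q × Fin q)) :
    inner ℝ x (Matrix.toEuclideanLin (rearrange p q (sampleCov z) - rearrange p q S) y) =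
      (1 / (n : ℝ)) *
        ∑ s, ((z s).ofLp ⬝ᵥ (kronOf x y *ᵥ (z s).ofLp) - frobInner S (kronOf x y)) := by
  have hn0 : (n : ℝ) ≠ 0 := by
    have : n ≠ 0 := by omega
    exact_mod_cast this
  rw [map_sub, LinearMap.sub_apply, inner_sub_right, inner_rearrange, inner_rearrange,
    frobInner_sampleCov, Finset.sum_sub_distrib, mul_sub, Finset.sum_const, Finset.card_univ,
    Fintype.card_fin, nsmul_eq_mul]
  field_simp

end Rearrangement

/-! ### Numerical constants and the choice of `t` -/

section Constants

lemma two_le_C₁ : 2 ≤ C₁ := by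
  unfold C₁
  rw [le_div_iff₀ (by positivity)]
  have he := Real.exp_one_gt_d9
  have h : √(6 * Real.pi) ≤ 5 := by
    rw [Real.sqrt_le_iff]
    constructor
    · norm_num
    · nlinarith [Real.pi_lt_four]
  linarith

lemma two_le_C₂ : 2 ≤ C₂ := by
  unfold C₂
  have he := Real.exp_one_gt_d9
  have h : 1 ≤ √2 := Real.one_le_sqrt.2 (by norm_num)
  nlinarith

lemma one_le_log_one_add {ε : ℝ} (hε₀ : 0 < ε) (hε : ε < 1 / 2) : 1 ≤ Real.log (1 + 2 / ε) := by
  rw [Real.le_log_iff_exp_le (by positivity)]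
  have he := Real.exp_one_lt_d9
  have : 4 ≤ 2 / ε := by rw [le_div_iff₀ hε₀]; linarith
  linarith

/-- The choice of `t` makes the Gaussian tail at level `t max {r, √r}`, `r = (D + ℓ) / n`, absorb
the entropy `D L` of the nets and leave a factor `exp (-t ℓ / (4 max {C₁, C₂}))`. The cases
`C₂ u ≤ C₁` and `C₁ ≤ C₂ u` are the sub-Gaussian and the sub-exponential regime. -/
lemma entropy_sub_tail_le {n D ℓ L t u : ℝ} (hn : 0 < n) (hD : 0 ≤ D) (hℓ : 0 ≤ ℓ) (hL : 1 ≤ L)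
    (ht₁ : 4 * C₁ * L ≤ t ^ 2) (ht₂ : 4 * C₂ * L ≤ t)
    (hu : u = t * max ((D + ℓ) / n) (√((D + ℓ) / n))) :
    D * L - n * u ^ 2 / (4 * (1 + u)) ≤ -(t / (4 * max C₁ C₂)) * ℓ := by
  have h1 := two_le_C₁
  have h2 := two_le_C₂
  have ht : 1 ≤ t := by nlinarith
  set ρ := (D + ℓ) / n with hρ
  have hρ0 : 0 ≤ ρ := by positivity
  have hρn : n * ρ = D + ℓ := by rw [hρ]; field_simp
  have hu0 : 0 ≤ u := by rw [hu]; positivity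
  have hu1 : t * ρ ≤ u := by rw [hu]; gcongr; exact le_max_left _ _
  have hu2 : t ^ 2 * ρ ≤ u ^ 2 := by
    have : t * √ρ ≤ u := by rw [hu]; gcongr; exact le_max_right _ _
    have h3 := pow_le_pow_left₀ (by positivity) this 2
    rwa [mul_pow, Real.sq_sqrt hρ0] at h3
  have hm1 : C₁ ≤ max C₁ C₂ := le_max_left _ _
  have hm2 : C₂ ≤ max C₁ C₂ := le_max_right _ _
  have htℓ : 0 ≤ t * ℓ := by positivity
  rcases le_total (C₂ * u) C₁ with hcase | hcase
  · have ha : t ^ 2 * (D + ℓ) / (4 * C₁) ≤ n * u ^ 2 / (4 * (1 + u)) := by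
      rw [← hρn]
      have e : t ^ 2 * (n * ρ) = n * (t ^ 2 * ρ) := by ring
      rw [e]
      apply div_le_div₀ (by positivity) (by gcongr) (by positivity)
      nlinarith
    have hb : D * L ≤ t ^ 2 * D / (4 * C₁) := by
      rw [le_div_iff₀ (by positivity)]
      nlinarith
    have hc : t / (4 * max C₁ C₂) * ℓ ≤ t ^ 2 * ℓ / (4 * C₁) := by
      rw [div_mul_eq_mul_div]
      apply div_le_div₀ (by positivity) (by nlinarith) (by positivity) (by linarith)
    have e : t ^ 2 * (D + ℓ) / (4 * C₁) = t ^ 2 * D / (4 * C₁) + t ^ 2 * ℓ / (4 * C₁) := by ring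
    linarith
  · have hu_pos : 0 < u := by
      by_contra! h
      nlinarith
    have ha : t * (D + ℓ) / (4 * C₂) ≤ n * u ^ 2 / (4 * (1 + u)) := by
      rw [← hρn]
      have e : n * u ^ 2 / (4 * (1 + u)) = n * u / (4 * ((1 + u) / u)) := by field_simp
      have e2 : t * (n * ρ) = n * (t * ρ) := by ring
      rw [e, e2]
      apply div_le_div₀ (by positivity) (by gcongr) (by positivity)
      have : (1 + u) / u ≤ C₂ := by
        rw [div_le_iff₀ hu_pos]
        nlinarith
      linarith
    have hb : D * L ≤ t * D / (4 * C₂) := by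
      rw [le_div_iff₀ (by positivity)]
      nlinarith
    have hc : t / (4 * max C₁ C₂) * ℓ ≤ t * ℓ / (4 * C₂) := by
      rw [div_mul_eq_mul_div]
      apply div_le_div_of_nonneg_left htℓ (by positivity) (by linarith)
    have e : t * (D + ℓ) / (4 * C₂) = t * D / (4 * C₂) + t * ℓ / (4 * C₂) := by ring
    linarith

end Constants

/-! ### Spectral norm of the noise -/

section Noise

lemma one_le_bigM {p q n : ℕ} (hp : 1 ≤ p) : 1 ≤ bigM p q n := by
  unfold bigM
  exact_mod_cast le_max_of_le_left (le_max_of_le_left hp)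

lemma log_bigM_nonneg {p q n : ℕ} (hp : 1 ≤ p) : 0 ≤ Real.log (bigM p q n) :=
  Real.log_nonneg (one_le_bigM hp)

lemma rate_nonneg {p q n : ℕ} (hp : 1 ≤ p) : 0 ≤ rate p q n := by
  have := log_bigM_nonneg (q := q) (n := n) hp
  unfold rate
  positivity

variable {Ω : Type*} [MeasurableSpace Ω] {P : Measure Ω} [IsProbabilityMeasure P]

/-- With high probability the rearranged sample covariance deviates from its expectation by at most
`lamN / 2` in spectral norm: union bound over nets of the two unit spheres. -/
theorem IsIIDGaussian.measureReal_noise_le {ε' t : ℝ} (hε₀ : 0 < ε') (hε : ε' < 1 / 2)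
    (ht : max (√(4 * C₁ * Real.log (1 + 2 / ε'))) (4 * C₂ * Real.log (1 + 2 / ε')) ≤ t)
    {p q n : ℕ} (hp : 1 ≤ p) (hn : 1 ≤ n)
    {S : Matrix (Fin p × Fin q) (Fin p × Fin q) ℝ} (hS : S.PosSemidef)
    {z : Fin n → Ω → EuclideanSpace ℝ (Fin p × Fin q)} (hz : IsIIDGaussian P S z) :
    P.real {ω | lamN (specNorm S) t ε' p q n / 2 <
      specNorm (rearrange p q (sampleCov fun s => z s ω) - rearrange p q S)} ≤
      bigM p q n ^ (-t / (4 * max C₁ C₂)) := by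
  set L := Real.log (1 + 2 / ε') with hL
  have hL1 : 1 ≤ L := one_le_log_one_add hε₀ hε
  have h2C₁ := two_le_C₁
  have h2C₂ := two_le_C₂
  have ht₁ : 4 * C₁ * L ≤ t ^ 2 := by
    have h := (le_max_left _ _).trans ht
    exact (Real.sqrt_le_left ((Real.sqrt_nonneg _).trans h)).1 h
  have ht₂ : 4 * C₂ * L ≤ t := (le_max_right _ _).trans ht
  have ht0 : 0 ≤ t := by nlinarith
  set u := t * max (rate p q n) (√(rate p q n)) with hu
  have hu0 : 0 ≤ u := mul_nonneg ht0 (le_max_of_le_right (Real.sqrt_nonneg _))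
  obtain ⟨N₁, hN₁, hnet₁, hcard₁⟩ := exists_net_unitSphere (EuclideanSpace ℝ (Fin p × Fin p)) hε₀
  obtain ⟨N₂, hN₂, hnet₂, hcard₂⟩ := exists_net_unitSphere (EuclideanSpace ℝ (Fin q × Fin q)) hε₀
  have hlam : lamN (specNorm S) t ε' p q n / 2 = specNorm S * u / (1 - 2 * ε') := by
    unfold lamN
    rw [hu]
    ring
  set Δ : Ω → Matrix (Fin p × Fin p) (Fin q × Fin q) ℝ := fun ω =>
    rearrange p q (sampleCov fun s => z s ω) - rearrange p q S with hΔ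
  have hsub : {ω | lamN (specNorm S) t ε' p q n / 2 < specNorm (Δ ω)} ⊆
      ⋃ xy ∈ N₁ ×ˢ N₂, {ω | specNorm S * u <
        inner ℝ xy.1 (Matrix.toEuclideanLin (Δ ω) xy.2)} := by
    intro ω hω
    by_contra hcon
    simp only [Set.mem_iUnion, not_exists, Finset.mem_product, Set.mem_ofPred_eq, not_lt] at hcon
    have h := specNorm_le_of_net (A := Δ ω) hε₀.le hε (mul_nonneg (specNorm_nonneg S) hu0)
      hN₁ hnet₁ hnet₂ fun x hx y hy => hcon (x, y) ⟨hx, hy⟩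
    rw [← hlam] at h
    exact absurd hω (not_lt.2 h)
  have hpair : ∀ xy ∈ N₁ ×ˢ N₂, P.real {ω | specNorm S * u <
      inner ℝ xy.1 (Matrix.toEuclideanLin (Δ ω) xy.2)} ≤
      Real.exp (-(n * u ^ 2 / (4 * (1 + u)))) := by
    rintro ⟨x, y⟩ hxy
    obtain ⟨hx, hy⟩ := Finset.mem_product.1 hxy
    simp only [hΔ, inner_rearrange_sampleCov_sub hn]
    refine hz.measureReal_quadForm_gt_le hS hn ?_ hu0
    rw [frobNorm_kronOf, hN₁ x hx, hN₂ y hy, one_mul]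
  have hexpL : Real.exp L = 1 + 2 / ε' := Real.exp_log (by positivity)
  have hfin : ∀ d : ℕ, Module.finrank ℝ (EuclideanSpace ℝ (Fin d × Fin d)) = d * d := by
    intro d; simp
  have hcards : ((N₁ ×ˢ N₂).card : ℝ) ≤ Real.exp (((p : ℝ) ^ 2 + (q : ℝ) ^ 2) * L) := by
    rw [Finset.card_product, Nat.cast_mul]
    refine (mul_le_mul hcard₁ hcard₂ (Nat.cast_nonneg _) (by positivity)).trans (le_of_eq ?_)
    rw [hfin, hfin, ← hexpL, ← Real.exp_nat_mul, ← Real.exp_nat_mul, ← Real.exp_add]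
    congr 1
    push_cast
    ring
  have hn0 : (0 : ℝ) < n := by exact_mod_cast hn
  have hM := one_le_bigM (q := q) (n := n) hp
  calc _ ≤ ∑ xy ∈ N₁ ×ˢ N₂, P.real {ω | specNorm S * u <
        inner ℝ xy.1 (Matrix.toEuclideanLin (Δ ω) xy.2)} :=
        (measureReal_mono hsub (measure_ne_top _ _)).trans (measureReal_biUnion_finset_le _ _)
    _ ≤ (N₁ ×ˢ N₂).card * Real.exp (-(n * u ^ 2 / (4 * (1 + u)))) := by
        rw [← nsmul_eq_mul]
        exact Finset.sum_le_card_nsmul _ _ _ hpair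
    _ ≤ Real.exp (((p : ℝ) ^ 2 + (q : ℝ) ^ 2) * L) * Real.exp (-(n * u ^ 2 / (4 * (1 + u)))) :=
        mul_le_mul_of_nonneg_right hcards (Real.exp_nonneg _)
    _ ≤ Real.exp (-(t / (4 * max C₁ C₂)) * Real.log (bigM p q n)) := by
        rw [← Real.exp_add]
        apply Real.exp_le_exp.2
        have h := entropy_sub_tail_le hn0 (by positivity : 0 ≤ (p : ℝ) ^ 2 + (q : ℝ) ^ 2)
          (log_bigM_nonneg (q := q) (n := n) hp) hL1 ht₁ ht₂ hu
        linarith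
    _ = _ := by
        rw [Real.rpow_def_of_pos (by linarith)]
        congr 1
        ring

end Noise

/-! ### Oracle inequality for the covariance estimator -/

section FiniteSample

lemma frobNorm_rearrange (p q : ℕ) (S : Matrix (Fin p × Fin q) (Fin p × Fin q) ℝ) :
    frobNorm (rearrange p q S) = frobNorm S := by
  rw [← sq_eq_sq₀ (frobNorm_nonneg _) (frobNorm_nonneg _), frobNorm_sq, frobNorm_sq]
  simp only [Fintype.sum_prod_type]
  refine Finset.sum_congr rfl fun i _ => ?_
  rw [Finset.sum_comm]
  rfl

lemma frobNorm_rearrange_symm_sub (p q : ℕ) (R : Matrix (Fin p × Fin p) (Fin q × Fin q) ℝ)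
    (S : Matrix (Fin p × Fin q) (Fin p × Fin q) ℝ) :
    frobNorm ((rearrange p q).symm R - S) = frobNorm (R - rearrange p q S) := by
  rw [← frobNorm_rearrange]
  rfl

lemma max_rate_sq {p q n : ℕ} (hp : 1 ≤ p) :
    max (rate p q n) (√(rate p q n)) ^ 2 = max (rate p q n ^ 2) (rate p q n) := by
  have h0 := rate_nonneg (q := q) (n := n) hp
  conv_rhs => rw [← Real.sq_sqrt h0, Real.sq_sqrt h0]
  rcases le_total (rate p q n) (√(rate p q n)) with h | h
  · have h2 := pow_le_pow_left₀ h0 h 2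
    rw [Real.sq_sqrt h0] at h2
    rw [max_eq_right h, max_eq_right h2, Real.sq_sqrt h0]
  · have h2 := pow_le_pow_left₀ (Real.sqrt_nonneg _) h 2
    rw [Real.sq_sqrt h0] at h2
    rw [max_eq_left h, max_eq_left h2]

/-- Oracle inequality for the covariance estimator on the event that the noise is dominated by the
penalty. -/
theorem oracle_inequality_of_noise_le {ε' t : ℝ} {p q n : ℕ} (hp : 1 ≤ p)
    {S Y : Matrix (Fin p × Fin q) (Fin p × Fin q) ℝ}
    {Rhat : Matrix (Fin p × Fin p) (Fin q × Fin q) ℝ}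
    (hR : IsPRLSSolution (lamN (specNorm S) t ε' p q n) (rearrange p q Y) Rhat)
    (hnoise : specNorm (rearrange p q Y - rearrange p q S) ≤ lamN (specNorm S) t ε' p q n / 2)
    {r : ℕ} (R : Matrix (Fin p × Fin p) (Fin q × Fin q) ℝ) (hRr : R.rank ≤ r) :
    frobNorm ((rearrange p q).symm Rhat - S) ^ 2 ≤ frobNorm (R - rearrange p q S) ^ 2 +
      (specNorm S * t * (1 + √2) / (1 - 2 * ε')) ^ 2 * r * max (rate p q n ^ 2) (rate p q n) := by
  rw [frobNorm_rearrange_symm_sub]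
  refine (hR.oracle_inequality hnoise R).trans (add_le_add le_rfl ?_)
  have e : ((1 + √2) * (lamN (specNorm S) t ε' p q n / 2)) ^ 2 =
      (specNorm S * t * (1 + √2) / (1 - 2 * ε')) ^ 2 * max (rate p q n ^ 2) (rate p q n) := by
    rw [← max_rate_sq hp, ← mul_pow, lamN]
    congr 1
    ring
  rw [e, mul_right_comm]
  have hr : (R.rank : ℝ) ≤ r := by exact_mod_cast hRr
  have : 0 ≤ max (rate p q n ^ 2) (rate p q n) := le_max_of_le_left (sq_nonneg _)
  gcongr

end FiniteSample

/-! ### Separation rank -/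

section SeparationRank

variable {p q r : ℕ} {S : Matrix (Fin p × Fin q) (Fin p × Fin q) ℝ}

/-- Rearrangement turns a Kronecker product into a rank-one matrix, so a sum of `r` of them
factors through `Fin r`. -/
lemma HasSeparationRank.rank_rearrange_le (h : HasSeparationRank S r) :
    (rearrange p q S).rank ≤ r := by
  obtain ⟨A, B, -, -, rfl⟩ := h
  have e : rearrange p q (∑ γ, Matrix.kroneckerMap (fun a b => a * b) (A γ) (B γ)) =
      (Matrix.of fun ij γ => A γ ij.1 ij.2 : Matrix (Fin p × Fin p) (Fin r) ℝ) *
        (Matrix.of fun γ kl => B γ kl.1 kl.2 : Matrix (Fin r) (Fin q × Fin q) ℝ) := by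
    ext ij kl
    change (∑ γ, Matrix.kroneckerMap (fun a b => a * b) (A γ) (B γ)) (ij.1, kl.1) (ij.2, kl.2) = _
    simp [Matrix.mul_apply, Matrix.sum_apply]
  rw [e]
  refine (Matrix.rank_mul_le_left _ _).trans ((Matrix.rank_le_card_width _).trans ?_)
  simp

end SeparationRank

/-! ### Tightness and rates -/

section Asymptotics

variable {Ω : Type*} [MeasurableSpace Ω] {P : Measure Ω} [IsProbabilityMeasure P]

lemma tendsto_measure_gt_atTop {Z : Ω → ℝ} (hZ : AEMeasurable Z P) :
    Tendsto (fun K : ℝ => P {ω | K < Z ω}) atTop (𝓝 0) := by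
  have h := tendsto_measure_iInter_atTop (μ := P) (s := fun K : ℝ => {ω | K < Z ω})
    (fun K => nullMeasurableSet_lt aemeasurable_const hZ)
    (fun K K' hK ω (hω : K' < Z ω) => lt_of_le_of_lt hK hω) ⟨0, measure_ne_top _ _⟩
  have hempty : ⋂ K : ℝ, {ω | K < Z ω} = ∅ := by
    ext ω
    simp only [Set.mem_iInter, Set.mem_ofPred_eq, Set.mem_empty_iff_false, iff_false, not_forall]
    exact ⟨Z ω, lt_irrefl _⟩
  rwa [hempty, measure_empty] at h

/-- A crude error bound valid for every sample, from comparing the minimizer with `0`. -/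
lemma IsPRLSSolution.frobNorm_sub_sq_le {m n : Type*} [Fintype m] [Fintype n] [DecidableEq m]
    [DecidableEq n] {lam : ℝ} (hlam : 0 ≤ lam) {Y Rhat : Matrix m n ℝ}
    (h : IsPRLSSolution lam Y Rhat) (R₀ : Matrix m n ℝ) :
    frobNorm (Rhat - R₀) ^ 2 ≤ 2 * frobNorm Y ^ 2 + 2 * frobNorm (Y - R₀) ^ 2 := by
  have h0 := isMinOn_iff.1 h 0 (Set.mem_univ _)
  simp only [sub_zero, nuclearNorm_zero, mul_zero, add_zero] at h0
  have h1 : frobNorm (Y - Rhat) ^ 2 ≤ frobNorm Y ^ 2 := by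
    linarith [mul_nonneg hlam (nuclearNorm_nonneg Rhat)]
  have h2 : frobNorm (Rhat - R₀) ≤ frobNorm (Y - Rhat) + frobNorm (Y - R₀) := by
    have e : Rhat - R₀ = (Rhat - Y) + (Y - R₀) := by abel
    rw [e, frobNorm_sub_comm Y Rhat]
    exact frobNorm_add_le _ _
  have h3 := pow_le_pow_left₀ (frobNorm_nonneg _) h2 2
  nlinarith [sq_nonneg (frobNorm (Y - Rhat) - frobNorm (Y - R₀))]

/-- For a single problem the estimation error is stochastically bounded, being dominated by a
polynomial in the sample. This needs no measurability of the estimator. -/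
lemma tendsto_measure_error_gt {p q n : ℕ} {lam b : ℝ} (hlam : 0 ≤ lam)
    {S : Matrix (Fin p × Fin q) (Fin p × Fin q) ℝ}
    {z : Fin n → Ω → EuclideanSpace ℝ (Fin p × Fin q)} (hz : ∀ s, AEMeasurable (z s) P)
    {Rhat : Ω → Matrix (Fin p × Fin p) (Fin q × Fin q) ℝ}
    (hR : ∀ ω, IsPRLSSolution lam (rearrange p q (sampleCov fun s => z s ω)) (Rhat ω)) :
    Tendsto (fun K : ℝ => P {ω | K < |frobNorm ((rearrange p q).symm (Rhat ω) - S) ^ 2 / b|})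
      atTop (𝓝 0) := by
  set F : (Fin n → EuclideanSpace ℝ (Fin p × Fin q)) → ℝ := fun w =>
    (2 * frobNorm (sampleCov w) ^ 2 + 2 * frobNorm (sampleCov w - S) ^ 2) / |b| with hF
  have hFm : Measurable F := by
    apply Continuous.measurable
    simp only [hF, frobNorm_sq, sampleCov, Matrix.sub_apply, Matrix.smul_apply, Matrix.sum_apply,
      Matrix.vecMulVec_apply]
    fun_prop
  have hZ : AEMeasurable (fun ω => F fun s => z s ω) P :=
    hFm.comp_aemeasurable (aemeasurable_pi_iff.2 hz)
  refine tendsto_of_tendsto_of_tendsto_of_le_of_le tendsto_const_nhds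
    (tendsto_measure_gt_atTop hZ) (fun _ => zero_le) fun K => measure_mono fun ω hω => ?_
  refine lt_of_lt_of_le (show K < _ from hω) ?_
  rw [abs_div, abs_of_nonneg (sq_nonneg _), hF]
  refine div_le_div_of_nonneg_right ?_ (abs_nonneg b)
  rw [frobNorm_rearrange_symm_sub]
  refine ((hR ω).frobNorm_sub_sq_le hlam _).trans (le_of_eq ?_)
  rw [frobNorm_rearrange, ← frobNorm_rearrange p q (sampleCov (fun s => z s ω) - S)]
  rfl

lemma inv_rate_le_bigM {p q n : ℕ} (hp : 1 ≤ p) (hn : 1 ≤ n) :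
    0 < rate p q n ∧ (rate p q n)⁻¹ ≤ bigM p q n := by
  have hn0 : (0 : ℝ) < n := by exact_mod_cast hn
  have hp1 : (1 : ℝ) ≤ p := by exact_mod_cast hp
  have hlog := log_bigM_nonneg (q := q) (n := n) hp
  have hnum : 1 ≤ (p : ℝ) ^ 2 + (q : ℝ) ^ 2 + Real.log (bigM p q n) := by nlinarith
  refine ⟨by unfold rate; positivity, ?_⟩
  have hnM : (n : ℝ) ≤ bigM p q n := by
    unfold bigM
    exact_mod_cast le_max_right _ _
  rw [rate, inv_div]
  exact (div_le_self hn0.le hnum).trans hnM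

/-- If the rate tends to zero, then the failure probabilities of the finite-sample bound tend to
zero, since `bigM ≥ rate⁻¹`. -/
lemma tendsto_bigM_rpow {p q n : ℕ → ℕ} (hp : ∀ k, 1 ≤ p k) (hn : ∀ k, 1 ≤ n k)
    (hrate : Tendsto (fun k => rate (p k) (q k) (n k)) atTop (𝓝 0)) {c : ℝ} (hc : 0 < c) :
    Tendsto (fun k => bigM (p k) (q k) (n k) ^ (-c)) atTop (𝓝 0) := by
  have hM : Tendsto (fun k => bigM (p k) (q k) (n k)) atTop atTop := by
    refine tendsto_atTop_mono (fun k => (inv_rate_le_bigM (q := q k) (hp k) (hn k)).2) ?_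
    refine tendsto_inv_nhdsGT_zero.comp (tendsto_nhdsWithin_iff.2 ⟨hrate, ?_⟩)
    exact Eventually.of_forall fun k => (inv_rate_le_bigM (hp k) (hn k)).1
  exact (tendsto_rpow_neg_atTop hc).comp hM

end Asymptotics

end PRLS

theorem theorem4 {Ω : Type*} [MeasurableSpace Ω] (P : Measure Ω) [IsProbabilityMeasure P]
    (ε' t : ℝ) (hε'_pos : 0 < ε') (hε'_lt : ε' < 1 / 2)
    (ht : max (√(4 * C₁ * Real.log (1 + 2 / ε'))) (4 * C₂ * Real.log (1 + 2 / ε')) ≤ t) :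
    -- finite-sample bound
    (∀ (p q n : ℕ), 1 ≤ p → 1 ≤ q → 1 ≤ n →
      ∀ S₀ : Matrix (Fin p × Fin q) (Fin p × Fin q) ℝ, S₀.PosSemidef →
      ∀ z : Fin n → Ω → EuclideanSpace ℝ (Fin p × Fin q), IsIIDGaussian P S₀ z →
      ∀ Rhat : Ω → Matrix (Fin p × Fin p) (Fin q × Fin q) ℝ,
        (∀ ω, IsPRLSSolution (lamN (specNorm S₀) t ε' p q n)
          (rearrange p q (sampleCov fun s => z s ω)) (Rhat ω)) →
      ∀ r : ℕ, 1 ≤ r → r ≤ min (p ^ 2) (q ^ 2) →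
        1 - 2 * bigM p q n ^ (-t / (4 * max C₁ C₂)) ≤
          P.real {ω | frobNorm ((rearrange p q).symm (Rhat ω) - S₀) ^ 2 ≤
            (⨅ R : {R : Matrix (Fin p × Fin p) (Fin q × Fin q) ℝ // R.rank ≤ r},
              frobNorm (R.1 - rearrange p q S₀) ^ 2) +
            (specNorm S₀ * t * (1 + √2) / (1 - 2 * ε')) ^ 2 * r *
              max (rate p q n ^ 2) (rate p q n)}) ∧
    -- rate of convergence for covariances of separation rank `r`
    (∀ (p q n r : ℕ → ℕ), (∀ k, 1 ≤ p k) → (∀ k, 1 ≤ q k) → (∀ k, 1 ≤ n k) → (∀ k, 1 ≤ r k) →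
      Tendsto (fun k => rate (p k) (q k) (n k)) atTop (𝓝 0) →
      ∀ S₀ : (k : ℕ) → Matrix (Fin (p k) × Fin (q k)) (Fin (p k) × Fin (q k)) ℝ,
        (∀ k, (S₀ k).PosSemidef) → (∀ k, HasSeparationRank (S₀ k) (r k)) →
        (∃ B : ℝ, ∀ k, specNorm (S₀ k) ≤ B) →
      ∀ z : (k : ℕ) → Fin (n k) → Ω → EuclideanSpace ℝ (Fin (p k) × Fin (q k)),
        (∀ k, IsIIDGaussian P (S₀ k) (z k)) →
      ∀ Rhat : (k : ℕ) → Ω → Matrix (Fin (p k) × Fin (p k)) (Fin (q k) × Fin (q k)) ℝ,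
        (∀ k ω, IsPRLSSolution (lamN (specNorm (S₀ k)) t ε' (p k) (q k) (n k))
          (rearrange (p k) (q k) (sampleCov fun s => z k s ω)) (Rhat k ω)) →
      IsBigOP P
        (fun k ω => frobNorm ((rearrange (p k) (q k)).symm (Rhat k ω) - S₀ k) ^ 2)
        (fun k => r k * rate (p k) (q k) (n k))) := by

  have h2C₁ := two_le_C₁
  have h2C₂ := two_le_C₂
  have ht0 : 0 < t := by
    have h1 := one_le_log_one_add hε'_pos hε'_lt
    have h2 : 4 * C₂ * Real.log (1 + 2 / ε') ≤ t := (le_max_right _ _).trans ht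
    nlinarith
  have hden : 0 < 1 - 2 * ε' := by linarith
  have hmax : 0 < max C₁ C₂ := lt_of_lt_of_le (by linarith) (le_max_left _ _)
  constructor
  · intro p q n hp _ hn S₀ hS z hz Rhat hR r _ _
    set good : Set Ω := {ω | frobNorm ((rearrange p q).symm (Rhat ω) - S₀) ^ 2 ≤
      (⨅ R : {R : Matrix (Fin p × Fin p) (Fin q × Fin q) ℝ // R.rank ≤ r},
        frobNorm (R.1 - rearrange p q S₀) ^ 2) +
      (specNorm S₀ * t * (1 + √2) / (1 - 2 * ε')) ^ 2 * r *
        max (rate p q n ^ 2) (rate p q n)} with hgood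
    set bad : Set Ω := {ω | lamN (specNorm S₀) t ε' p q n / 2 <
      specNorm (rearrange p q (sampleCov fun s => z s ω) - rearrange p q S₀)} with hbad
    have hcover : Set.univ ⊆ good ∪ bad := by
      intro ω _
      by_cases hω : ω ∈ bad
      · exact Or.inr hω
      · left
        have hne : Nonempty {R : Matrix (Fin p × Fin p) (Fin q × Fin q) ℝ // R.rank ≤ r} :=
          ⟨⟨0, by simp⟩⟩
        rw [hgood, Set.mem_ofPred_eq, ← sub_le_iff_le_add]
        refine le_ciInf fun R => ?_
        rw [sub_le_iff_le_add]
        exact oracle_inequality_of_noise_le hp (hR ω) (not_lt.1 hω) R.1 R.2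
    have h1 : (1 : ℝ) ≤ P.real good + P.real bad := by
      rw [← probReal_univ (μ := P)]
      exact (measureReal_mono hcover).trans (measureReal_union_le _ _)
    have h2 := hz.measureReal_noise_le hε'_pos hε'_lt ht hp hn hS
    have h3 : 0 ≤ bigM p q n ^ (-t / (4 * max C₁ C₂)) :=
      Real.rpow_nonneg (zero_le_one.trans (one_le_bigM hp)) _
    linarith
  · intro p q n r hp _ hn hr hrate S₀ hS hsep ⟨B, hB⟩ z hz Rhat hR
    set X : ℕ → Ω → ℝ := fun k ω =>
      frobNorm ((rearrange (p k) (q k)).symm (Rhat k ω) - S₀ k) ^ 2 with hX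
    set K₀ : ℝ := (B * t * (1 + √2) / (1 - 2 * ε')) ^ 2 with hK₀
    rw [IsBigOP, ENNReal.tendsto_nhds_zero]
    intro δ hδ
    -- for all but finitely many problems the error is controlled off the noise event
    have hlarge : ∀ᶠ k in atTop, ∀ K, K₀ ≤ K →
        P {ω | K < |X k ω / (r k * rate (p k) (q k) (n k))|} ≤ δ := by
      have hprob := ENNReal.tendsto_ofReal (tendsto_bigM_rpow hp hn hrate
        (show 0 < t / (4 * max C₁ C₂) by positivity))
      rw [ENNReal.ofReal_zero] at hprob
      filter_upwards [ENNReal.tendsto_nhds_zero.1 hprob δ hδ,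
        hrate.eventually_le_const zero_lt_one] with k hk hk1 K hK
      refine le_trans ?_ hk
      have hbad := (hz k).measureReal_noise_le hε'_pos hε'_lt ht (hp k) (hn k) (hS k)
      rw [neg_div] at hbad
      refine le_trans ?_ (ENNReal.ofReal_le_ofReal hbad)
      rw [ofReal_measureReal]
      refine measure_mono fun ω hω => ?_
      by_contra hgood
      rw [Set.mem_ofPred_eq, not_lt] at hgood
      have hrate0 := (inv_rate_le_bigM (q := q k) (hp k) (hn k)).1
      have hr0 : (0 : ℝ) < r k := by exact_mod_cast hr k
      have h := oracle_inequality_of_noise_le (hp k) (hR k ω) hgood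
        (rearrange (p k) (q k) (S₀ k)) (hsep k).rank_rearrange_le
      rw [sub_self, frobNorm_sq (0 : Matrix (Fin (p k) × Fin (p k)) (Fin (q k) × Fin (q k)) ℝ)] at h
      have hmaxr : max (rate (p k) (q k) (n k) ^ 2) (rate (p k) (q k) (n k)) =
          rate (p k) (q k) (n k) := max_eq_right (by nlinarith)
      rw [hmaxr] at h
      have hC : (specNorm (S₀ k) * t * (1 + √2) / (1 - 2 * ε')) ^ 2 ≤ K₀ := by
        have := specNorm_nonneg (S₀ k)
        have := hB k
        rw [hK₀]
        gcongr
      have hXle : X k ω ≤ K₀ * (r k * rate (p k) (q k) (n k)) := by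
        refine h.trans ?_
        simp only [Matrix.zero_apply, ne_eq, OfNat.ofNat_ne_zero, not_false_eq_true, zero_pow,
          Finset.sum_const_zero, zero_add]
        rw [mul_assoc]
        exact mul_le_mul_of_nonneg_right hC (by positivity)
      rw [Set.mem_ofPred_eq, abs_of_nonneg (div_nonneg (sq_nonneg _) (by positivity)),
        lt_div_iff₀ (by positivity)] at hω
      have := mul_le_mul_of_nonneg_right hK (by positivity : 0 ≤ r k * rate (p k) (q k) (n k))
      linarith
    obtain ⟨k₀, hk₀⟩ := eventually_atTop.1 hlarge
    have hsmall : ∀ᶠ K : ℝ in atTop, ∀ k ∈ Finset.range k₀,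
        P {ω | K < |X k ω / (r k * rate (p k) (q k) (n k))|} ≤ δ := by
      rw [eventually_all_finset]
      intro k _
      have hlam : 0 ≤ lamN (specNorm (S₀ k)) t ε' (p k) (q k) (n k) := by
        have := specNorm_nonneg (S₀ k)
        have : 0 ≤ max (rate (p k) (q k) (n k)) (√(rate (p k) (q k) (n k))) :=
          le_max_of_le_right (Real.sqrt_nonneg _)
        unfold lamN
        positivity
      exact ENNReal.tendsto_nhds_zero.1 (tendsto_measure_error_gt hlam
        (fun s => ((hz k).2 s).aemeasurable) (hR k)) δ hδ
    filter_upwards [hsmall, eventually_ge_atTop K₀] with K hK hKK₀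
    refine iSup_le fun k => ?_
    rcases lt_or_ge k k₀ with hk | hk
    · exact hK k (Finset.mem_range.2 hk)
    · exact hk₀ k hk K hKK₀
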